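/- Notation. $|\cdot|$ is the Euclidean norm. A lower index denotes a fibre with that variable (or those variables) held fixed, e.g. $f_x(y,z)=f(x,y,z)$ and $f_{x,y}(z)=f(x,y,z)$; primes denote derivatives in the remaining variable. For $W\subset\mathbb R^d$ closed and bounded, a function $g:\mathbb R^d\setminus W\to\mathbb R$ is of *decrease $n$* if there is $C>0$ with $|g(p)|\le C/|p|^n$ for all $p\in\mathbb R^d\setminus W$ with $|p|>1$. Dimension 1. With $W\subset\mathbb R$ closed and bounded, a smooth $g:\mathbb R\setminus W\to\mathbb R$ is *analytic at infinity* if there are $\epsilon_1,\epsilon_2>0$ and real sequences $(a_n)_{n\ge1},(b_n)_{n\ge 1}$ such that $g(1/x)=\sum_{n\ge1}a_nx^n$ for $0<x<\epsilon_1$ and $g(1/x)=\sum_{n\ge1}b_nx^n$ for $-\epsilon_2<x<0$, both series being absolutely convergent. Dimension 2. Let $W\subset\mathbb R^2$ be closed and bounded and $g:\mathbb R^2\setminus W\to\mathbb R$ smooth. Consider the conditions: (i) $g_x$ is analytic at infinity for every $x\in\mathbb R$; (ii) $g_y$ is analytic at infinity for every $y\in\mathbb R$; (iii) $g$ is of decrease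 $1$; (iv) $\partial g/\partial x$ and $\partial g/\partial y$ are of decrease $2$. The function $g$ is *quasi normal* if (i)–(iv) hold and there are constants $K,L$ such that for $|x|>K$ the zeros of each of $g_x,(g_x)',(g_x)''$ are contained in a set $(-M,-N)\cup(N,M)$ with $M,N\in\mathbb R$, $M-N\le L$ ($M,N$ may depend on $x$ and on which of the three functions is considered), and likewise for $g_y,(g_y)',(g_y)''$ when $|y|>K$. It is *quasi split normal* if (i)–(iv) hold and, for all sufficiently large $(x,y)$, $g=g_1+g_2$, where $g_1,g_2$ are quasi normal (each one defined and smooth off some closed bounded set). Dimension 3. Let $f:\mathbb R^3\to\mathbb R$ be smooth. Consider the conditions: (iv) $f$ is of decrease $1$; (v) for all $i,j,k\ge 0$ with $i+j+k\ge1$, $\partial^{i+j+k}f/\partial x^i\partial y^j\partial z^k$ is of decrease $i+j+k+1$. A function $g(x,y,z)$, defined at least for all large $(x,y)$ and all $z$, has *zeros in intervals with respect to $(x,y)$* if there are $K,R\in\mathbb R$ and $S\in\mathbb N$ such that for every $(x,y)$ with $|(x,y)|>K$ the zeros of each of $g_{x,y},(g_{x,y})',(g_{x,y})'',(g_{x,y})''',(g_{x,y})''''$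 are contained in a union of $S$ bounded intervals of total length at most $R$; similarly for $(x,z)$ and $(y,z)$. The function $f$ is *quasi normal* if all its fibres $f_x,f_y,f_z$ (for all $x,y,z\in\mathbb R$) are quasi normal functions on $\mathbb R^2$, (iv) and (v) hold, and $f$ has zeros in intervals with respect to $(x,y)$, to $(x,z)$ and to $(y,z)$. It is *quasi split normal* if all its fibres $f_x,f_y,f_z$ are quasi split normal functions on $\mathbb R^2$, (iv) and (v) hold, and, for all sufficiently large $(x,y)$ and all $z$, $f=f_1+f_2$ with $f_1,f_2$ smooth there and having zeros in intervals with respect to $(x,y)$; and similarly for $(x,z)$ and for $(y,z)$. Statement. Let $f:\mathbb R^3\to\mathbb R$ be smooth and either quasi normal or quasi split normal. Then for all $x,y,z\in\mathbb R$ and all nonzero real $k_1,k_2,k_3$ the limits $$A(k_1,y,z)=\lim_{r\to\infty}\int_{-r}^{r}f(x,y,z)e^{-ik_1x}\,dx,\quad B(x,k_2,z)=\lim_{r\to\infty}\int_{-r}^{r}f(x,y,z)e^{-ik_2y}\,dy,\quad C(x,y,k_3)=\lim_{r\to\infty}\int_{-r}^{r}f(x,y,z)e^{-ik_3z}\,dz,$$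 $$F(k_1,k_2,z)=\lim_{r,s\to\infty}\int_{-r}^{r}\int_{-s}^{s}f(x,y,z)e^{-ik_1x}e^{-ik_2y}\,dx\,dy,$$ $$G(k_1,y,k_3)=\lim_{r,s\to\infty}\int_{-r}^{r}\int_{-s}^{s}f(x,y,z)e^{-ik_1x}e^{-ik_3z}\,dx\,dz,$$ $$H(x,k_2,k_3)=\lim_{r,s\to\infty}\int_{-r}^{r}\int_{-s}^{s}f(x,y,z)e^{-ik_2y}e^{-ik_3z}\,dy\,dz$$ exist (with $r,s$ tending to infinity independently). For all nonzero $k_1,k_2,k_3$ the integrands in the following six integrals are Lebesgue integrable (over $\mathbb R^2$, respectively $\mathbb R$), so that one can define $$A(k_1,k_2,k_3)=\int_{-\infty}^{\infty}\int_{-\infty}^{\infty}A(k_1,y,z)e^{-ik_2y}e^{-ik_3z}\,dy\,dz,\qquad F(k_1,k_2,k_3)=\int_{-\infty}^{\infty}F(k_1,k_2,z)e^{-ik_3z}\,dz,$$ $$B(k_1,k_2,k_3)=\int_{-\infty}^{\infty}\int_{-\infty}^{\infty}B(x,k_2,z)e^{-ik_1x}e^{-ik_3z}\,dx\,dz,\qquad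 G(k_1,k_2,k_3)=\int_{-\infty}^{\infty}G(k_1,y,k_3)e^{-ik_2y}\,dy,$$ $$C(k_1,k_2,k_3)=\int_{-\infty}^{\infty}\int_{-\infty}^{\infty}C(x,y,k_3)e^{-ik_1x}e^{-ik_2y}\,dx\,dy,\qquad H(k_1,k_2,k_3)=\int_{-\infty}^{\infty}H(x,k_2,k_3)e^{-ik_1x}\,dx,$$ and all six agree and equal the limit of the integrals over boxes: $$A=B=C=F=G=H=\lim_{r\to\infty,\,s\to\infty,\,t\to\infty}\int_{-r}^{r}\int_{-s}^{s}\int_{-t}^{t}f(x,y,z)e^{-ik_1x}e^{-ik_2y}e^{-ik_3z}\,dx\,dy\,dz,$$ where $r,s,t$ tend to infinity independently. -/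

import Mathlib

open MeasureTheory Filter Topology Set
open scoped ContDiff

/-- `f : ℝ ∖ W → ℝ` (given by a total function whose values on `W` are irrelevant) is analytic at
infinity: `W` is closed and bounded, `f` is smooth off `W`, and `f (1/x)` is the sum of a convergent
power series without constant term for small `x > 0`, and of another one for small `x < 0`.
(In `ℝ`, `HasSum` is absolute convergence.  As `W` is bounded, `1/x ∉ W` for small `x`.) -/
structure IsAnalyticAtInfinity (W : Set ℝ) (f : ℝ → ℝ) : Prop where
  isClosed : IsClosed W
  isBounded : Bornology.IsBounded W
  smooth : ContDiffOn ℝ ∞ f Wᶜ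
  pos : ∃ ε > 0, ∃ a : ℕ → ℝ, ∀ x : ℝ, 0 < x → x < ε →
    HasSum (fun n : ℕ => a (n + 1) * x ^ (n + 1)) (f (1 / x))
  neg : ∃ ε > 0, ∃ b : ℕ → ℝ, ∀ x : ℝ, -ε < x → x < 0 →
    HasSum (fun n : ℕ => b (n + 1) * x ^ (n + 1)) (f (1 / x))

/-! ### Functions on the plane -/

/-- `|f(x,y)| ≤ C / |(x,y)|^n` on the part of `ℝ² ∖ W` with `|(x,y)| > 1`
(`n = 1`: very moderate decrease, `n = 2`: moderate decrease). -/
def IsOfDecrease₂ (n : ℕ) (W : Set (ℝ × ℝ)) (f : ℝ → ℝ → ℝ) : Prop :=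
  ∃ C > 0, ∀ x y : ℝ, (x, y) ∉ W → 1 < √(x ^ 2 + y ^ 2) → |f x y| ≤ C / √(x ^ 2 + y ^ 2) ^ n

/-- For all `x` with `|x|` large, the zeros of `f_x`, of `(f_x)'` and of `(f_x)''` lie (for each of
the three functions) in a set `(-M, -N) ∪ (N, M)` with `M - N` bounded uniformly in `x`.
(If `f` is only given off a bounded set, `f_x` is everywhere defined for `|x|` large.) -/
def HasZerosInSymmetricIntervals (f : ℝ → ℝ → ℝ) : Prop :=
  ∃ K L : ℝ, ∀ x : ℝ, K < |x| → ∀ j : ℕ, j ≤ 2 → ∃ M N : ℝ, M - N ≤ L ∧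
    ∀ y : ℝ, iteratedDeriv j (f x) y = 0 → y ∈ Ioo (-M) (-N) ∪ Ioo N M

/-- The conditions shared by quasi normal and quasi split normal functions on `ℝ² ∖ W`. -/
structure IsPreNormal₂ (W : Set (ℝ × ℝ)) (f : ℝ → ℝ → ℝ) : Prop where
  isClosed : IsClosed W
  isBounded : Bornology.IsBounded W
  smooth : ContDiffOn ℝ ∞ (fun p : ℝ × ℝ => f p.1 p.2) Wᶜ
  fibre_x : ∀ x : ℝ, IsAnalyticAtInfinity {y | (x, y) ∈ W} (fun y => f x y)
  fibre_y : ∀ y : ℝ, IsAnalyticAtInfinity {x | (x, y) ∈ W} (fun x => f x y)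
  decrease : IsOfDecrease₂ 1 W f
  decrease_dx : IsOfDecrease₂ 2 W (fun x y => deriv (fun x' => f x' y) x)
  decrease_dy : IsOfDecrease₂ 2 W (fun x y => deriv (fun y' => f x y') y)

/-- Quasi normal functions `f : ℝ² ∖ W → ℝ`. -/
structure IsQuasiNormal₂ (W : Set (ℝ × ℝ)) (f : ℝ → ℝ → ℝ) : Prop where
  preNormal : IsPreNormal₂ W f
  zeros_x : HasZerosInSymmetricIntervals (fun x y => f x y)
  zeros_y : HasZerosInSymmetricIntervals (fun y x => f x y)

/-- Quasi split normal functions `f : ℝ² ∖ W → ℝ`: near infinity `f` is the sum of two quasi normal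
functions, each of them defined and smooth off some closed bounded set. -/
structure IsQuasiSplitNormal₂ (W : Set (ℝ × ℝ)) (f : ℝ → ℝ → ℝ) : Prop where
  preNormal : IsPreNormal₂ W f
  split : ∃ (W₁ W₂ : Set (ℝ × ℝ)) (f₁ f₂ : ℝ → ℝ → ℝ) (K : ℝ),
    IsQuasiNormal₂ W₁ f₁ ∧ IsQuasiNormal₂ W₂ f₂ ∧
      ∀ x y : ℝ, K < √(x ^ 2 + y ^ 2) → f x y = f₁ x y + f₂ x y

/-! ### Functions on space -/

/-- `|f(x,y,z)| ≤ C / |(x,y,z)|^n` on the part of `ℝ³ ∖ W` with `|(x,y,z)| > 1`. -/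
def IsOfDecrease₃ (n : ℕ) (W : Set (ℝ × ℝ × ℝ)) (f : ℝ → ℝ → ℝ → ℝ) : Prop :=
  ∃ C > 0, ∀ x y z : ℝ, (x, y, z) ∉ W → 1 < √(x ^ 2 + y ^ 2 + z ^ 2) →
    |f x y z| ≤ C / √(x ^ 2 + y ^ 2 + z ^ 2) ^ n

/-- The partial derivative `∂^{i+j+k} f / ∂x^i ∂y^j ∂z^k`. -/
noncomputable def partialDeriv₃ (i j k : ℕ) (f : ℝ → ℝ → ℝ → ℝ) (x y z : ℝ) : ℝ :=
  iteratedDeriv i (fun x' => iteratedDeriv j (fun y' => iteratedDeriv k (fun z' => f x' y' z') z) y) x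

/-- For all `(u,v)` with `|(u,v)|` large, the zeros of `f_{u,v}` and of its first four derivatives
are contained in a union of `S` intervals of total length at most `R`, with `S` and `R` independent
of `(u,v)`. -/
def HasZerosInIntervals (f : ℝ → ℝ → ℝ → ℝ) : Prop :=
  ∃ (K R : ℝ) (S : ℕ), ∀ u v : ℝ, K < √(u ^ 2 + v ^ 2) → ∀ j : ℕ, j ≤ 4 →
    ∃ a b : Fin S → ℝ, (∀ i, a i ≤ b i) ∧ ∑ i, (b i - a i) ≤ R ∧
      ∀ w : ℝ, iteratedDeriv j (f u v) w = 0 → ∃ i, w ∈ Icc (a i) (b i)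

/-- For all `(u,v)` with `|(u,v)|` large, `f = f₁ + f₂` with `f₁`, `f₂` smooth and such that
both have the property `HasZerosInIntervals`. -/
def HasSplitZerosInIntervals (f : ℝ → ℝ → ℝ → ℝ) : Prop :=
  ∃ (K : ℝ) (f₁ f₂ : ℝ → ℝ → ℝ → ℝ),
    ContDiffOn ℝ ∞ (fun p : ℝ × ℝ × ℝ => f₁ p.1 p.2.1 p.2.2) {p | K < √(p.1 ^ 2 + p.2.1 ^ 2)} ∧
    ContDiffOn ℝ ∞ (fun p : ℝ × ℝ × ℝ => f₂ p.1 p.2.1 p.2.2) {p | K < √(p.1 ^ 2 + p.2.1 ^ 2)} ∧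
    (∀ u v w : ℝ, K < √(u ^ 2 + v ^ 2) → f u v w = f₁ u v w + f₂ u v w) ∧
    HasZerosInIntervals f₁ ∧ HasZerosInIntervals f₂

/-- The conditions, other than those on fibres and zeros, shared by quasi normal and quasi split
normal functions on `ℝ³ ∖ W`. -/
structure IsPreNormal₃ (W : Set (ℝ × ℝ × ℝ)) (f : ℝ → ℝ → ℝ → ℝ) : Prop where
  isClosed : IsClosed W
  isBounded : Bornology.IsBounded W
  smooth : ContDiffOn ℝ ∞ (fun p : ℝ × ℝ × ℝ => f p.1 p.2.1 p.2.2) Wᶜ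
  decrease : IsOfDecrease₃ 1 W f
  decrease_partialDeriv : ∀ i j k : ℕ, 1 ≤ i + j + k →
    IsOfDecrease₃ (i + j + k + 1) W (partialDeriv₃ i j k f)

/-- Quasi normal functions `f : ℝ³ ∖ W → ℝ`. -/
structure IsQuasiNormal₃ (W : Set (ℝ × ℝ × ℝ)) (f : ℝ → ℝ → ℝ → ℝ) : Prop where
  preNormal : IsPreNormal₃ W f
  fibre_x : ∀ x : ℝ, IsQuasiNormal₂ {p | (x, p.1, p.2) ∈ W} (fun y z => f x y z)
  fibre_y : ∀ y : ℝ, IsQuasiNormal₂ {p | (p.1, y, p.2) ∈ W} (fun x z => f x y z)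
  fibre_z : ∀ z : ℝ, IsQuasiNormal₂ {p | (p.1, p.2, z) ∈ W} (fun x y => f x y z)
  zeros_xy : HasZerosInIntervals (fun x y z => f x y z)
  zeros_xz : HasZerosInIntervals (fun x z y => f x y z)
  zeros_yz : HasZerosInIntervals (fun y z x => f x y z)

/-- Quasi split normal functions `f : ℝ³ ∖ W → ℝ`. -/
structure IsQuasiSplitNormal₃ (W : Set (ℝ × ℝ × ℝ)) (f : ℝ → ℝ → ℝ → ℝ) : Prop where
  preNormal : IsPreNormal₃ W f
  fibre_x : ∀ x : ℝ, IsQuasiSplitNormal₂ {p | (x, p.1, p.2) ∈ W} (fun y z => f x y z)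
  fibre_y : ∀ y : ℝ, IsQuasiSplitNormal₂ {p | (p.1, y, p.2) ∈ W} (fun x z => f x y z)
  fibre_z : ∀ z : ℝ, IsQuasiSplitNormal₂ {p | (p.1, p.2, z) ∈ W} (fun x y => f x y z)
  zeros_xy : HasSplitZerosInIntervals (fun x y z => f x y z)
  zeros_xz : HasSplitZerosInIntervals (fun x z y => f x y z)
  zeros_yz : HasSplitZerosInIntervals (fun y z x => f x y z)

/-- The Fourier kernel `e^{-ikx}`. -/
noncomputable def fourierKernel (k x : ℝ) : ℂ := Complex.exp (-(Complex.I * k * x))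

/-! Everything follows from symbol estimates: every partial derivative of `f` of total order `n` is
`O((1 + x² + y² + z²)^(-(n+1)/2))`. Write `w` for `decayWeight`. Since `(1 + x² + y² + z²)^(-1/2) ≤
w(x) w(y) w(z)`, the decay can be shared among the variables. Each derivative gains three more
factors of the weight, which may all be given to the variable of differentiation. So a mixed
derivative of order at most one in each variable is bounded by a product with `w` for each
undifferentiated variable and `w⁴` for each differentiated one, and `w⁴ = (1 + x²)^(-2/3)` is
integrable.

For `k ≠ 0`, one integration by parts turns a truncated transform into boundary terms that vanish at
infinity plus an absolutely convergent integral. This bounds the truncated transform uniformly in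
the radius and makes it Cauchy with an explicit rate. A transform in one variable commutes with
derivatives and bounds in the others, so the argument can be iterated (`DecayC3.transform`,
`DecayC2.transform`): integrals over rectangles and boxes are Cauchy as all radii grow
independently.

For absolute integrability of the single transforms, integrate by parts twice
(`SymbolBound.norm_improperTransform_le`). The second derivative decays to order three, which leaves
`w⁴` in each of the two remaining variables. The joint limit, already known to exist, is then
identified with the iterated integral (`tendsto_prod_of_iterated`). The different orders of
integration agree because the box integrals do, by Fubini on compact sets, and because Fubini
applies to the absolutely integrable single transforms. -/

/-! ### The weight -/

/-- The weight `(1 + x²)^(-1/6)`. -/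
noncomputable def decayWeight (x : ℝ) : ℝ := (1 + x ^ 2) ^ (-(1 / 6) : ℝ)

lemma decayWeight_pos (x : ℝ) : 0 < decayWeight x := by unfold decayWeight; positivity

lemma decayWeight_nonneg (x : ℝ) : 0 ≤ decayWeight x := (decayWeight_pos x).le

lemma decayWeight_le_one (x : ℝ) : decayWeight x ≤ 1 :=
  Real.rpow_le_one_of_one_le_of_nonpos (by nlinarith [sq_nonneg x]) (by norm_num)

lemma decayWeight_neg (x : ℝ) : decayWeight (-x) = decayWeight x := by simp [decayWeight]

lemma tendsto_decayWeight : Tendsto decayWeight atTop (𝓝 0) := by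
  have h1 : Tendsto (fun x : ℝ => 1 + x ^ 2) atTop atTop :=
    tendsto_atTop_add_const_left _ _ (tendsto_pow_atTop two_ne_zero)
  exact (tendsto_rpow_neg_atTop (by norm_num : (0 : ℝ) < 1 / 6)).comp h1

/-- The fourth power occurs because a differentiated variable carries its original factor and the
three gained from the derivative; the exponent `2/3` exceeds the threshold `1/2`. -/
lemma integrable_decayWeight_pow_four : Integrable fun x => decayWeight x ^ 4 := by
  have h := integrable_rpow_neg_one_add_norm_sq (E := ℝ) (μ := volume) (r := 4 / 3)
    (by simp; norm_num)
  refine h.congr (Eventually.of_forall fun x => ?_)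
  simp only [decayWeight, Real.norm_eq_abs, sq_abs]
  rw [← Real.rpow_mul_natCast (by positivity)]
  norm_num

/-! ### The kernel and the truncated transform -/

lemma continuous_fourierKernel (k : ℝ) : Continuous (fourierKernel k) := by
  unfold fourierKernel; fun_prop

@[fun_prop]
lemma Continuous.fourierKernel {X : Type*} [TopologicalSpace X] (k : ℝ) {u : X → ℝ}
    (hu : Continuous u) : Continuous fun p => fourierKernel k (u p) :=
  (continuous_fourierKernel k).comp hu

@[simp]
lemma norm_fourierKernel (k x : ℝ) : ‖fourierKernel k x‖ = 1 := by
  simp [fourierKernel, Complex.norm_exp]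

lemma hasDerivAt_fourierKernel (k x : ℝ) :
    HasDerivAt (fourierKernel k) (-(Complex.I * k) * fourierKernel k x) x := by
  have h1 : HasDerivAt (fun x : ℝ => -(Complex.I * k) * (x : ℂ)) (-(Complex.I * k)) x := by
    simpa using (Complex.ofRealCLM.hasDerivAt (x := x)).const_mul (-(Complex.I * (k : ℂ)))
  have h2 : fourierKernel k = fun x : ℝ => Complex.exp (-(Complex.I * k) * (x : ℂ)) := by
    ext x; simp [fourierKernel]
  rw [h2]
  exact h1.cexp.congr_deriv (mul_comm _ _)

/-- The truncated Fourier transform `∫_{-r}^{r} u(x) e^{-ikx} dx`. -/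
noncomputable def truncTransform (k r : ℝ) (u : ℝ → ℂ) : ℂ :=
  ∫ x in (-r)..r, u x * fourierKernel k x

lemma truncTransform_sub (k r : ℝ) {u v : ℝ → ℂ} (hu : Continuous u) (hv : Continuous v) :
    truncTransform k r (fun x => u x - v x) = truncTransform k r u - truncTransform k r v := by
  simp only [truncTransform, sub_mul]
  exact intervalIntegral.integral_sub (Continuous.intervalIntegrable (by fun_prop) _ _)
    (Continuous.intervalIntegrable (by fun_prop) _ _)

/-- Integration by parts, with the division by `ik` that requires a nonzero frequency. It trades a
slowly decaying function for its derivative, which will be absolutely integrable. -/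
lemma truncTransform_eq_of_hasDerivAt {k : ℝ} (hk : k ≠ 0) (r : ℝ) {u u' : ℝ → ℂ}
    (hu : ∀ x, HasDerivAt u (u' x) x) (hu' : Continuous u') :
    truncTransform k r u = (Complex.I * k)⁻¹ *
      (truncTransform k r u' - (u r * fourierKernel k r - u (-r) * fourierKernel k (-r))) := by
  have hk' : Complex.I * (k : ℂ) ≠ 0 := mul_ne_zero Complex.I_ne_zero (by exact_mod_cast hk)
  have h := intervalIntegral.integral_mul_deriv_eq_deriv_mul (a := -r) (b := r)
    (fun x _ => hu x) (fun x _ => hasDerivAt_fourierKernel k x)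
    (hu'.intervalIntegrable _ _) (Continuous.intervalIntegrable (by fun_prop) _ _)
  have h2 : ∫ x in (-r)..r, u x * (-(Complex.I * k) * fourierKernel k x)
      = -(Complex.I * k) * truncTransform k r u := by
    rw [truncTransform, ← intervalIntegral.integral_const_mul]
    congr 1; ext x; ring
  rw [h2] at h
  rw [eq_inv_mul_iff_mul_eq₀ hk']
  simp only [truncTransform] at h ⊢
  linear_combination -h

/-- `u` is continuously differentiable, with `u` and `u'` dominated by `a (1 + x²)^(-1/6)` and
`a (1 + x²)^(-2/3)`. -/
def DecayC1 (a : ℝ) (u : ℝ → ℂ) : Prop :=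
  ∃ u' : ℝ → ℂ, Continuous u' ∧ (∀ x, HasDerivAt u (u' x) x) ∧
    (∀ x, ‖u x‖ ≤ a * decayWeight x) ∧ ∀ x, ‖u' x‖ ≤ a * decayWeight x ^ 4

lemma DecayC1.continuous {a : ℝ} {u : ℝ → ℂ} (h : DecayC1 a u) : Continuous u := by
  obtain ⟨u', -, hd, -⟩ := h
  exact continuous_iff_continuousAt.2 fun x => (hd x).continuousAt

/-- A bound for the truncated transform on `DecayC1 1`. -/
noncomputable def transformConst (k : ℝ) : ℝ := |k|⁻¹ * (2 + ∫ x, decayWeight x ^ 4)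

/-- A bound for the tail of the transform on `DecayC1 1`. -/
noncomputable def transformTail (k r : ℝ) : ℝ :=
  |k|⁻¹ * (2 * decayWeight r + ((∫ x, decayWeight x ^ 4) - ∫ x in (-r)..r, decayWeight x ^ 4))

lemma tendsto_transformTail (k : ℝ) : Tendsto (transformTail k) atTop (𝓝 0) := by
  have h1 := intervalIntegral_tendsto_integral integrable_decayWeight_pow_four
    tendsto_neg_atTop_atBot tendsto_id
  have h2 := ((tendsto_decayWeight.const_mul 2).add
    (h1.const_sub (∫ x, decayWeight x ^ 4))).const_mul |k|⁻¹
  simp only [mul_zero, sub_self, add_zero] at h2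
  exact h2

lemma norm_inv_I_mul (k : ℝ) : ‖(Complex.I * (k : ℂ))⁻¹‖ = |k|⁻¹ := by simp

lemma norm_boundary_le {a : ℝ} {u : ℝ → ℂ} (hu : ∀ x, ‖u x‖ ≤ a * decayWeight x) (k r : ℝ) :
    ‖u r * fourierKernel k r - u (-r) * fourierKernel k (-r)‖ ≤ a * (2 * decayWeight r) := by
  refine (norm_sub_le _ _).trans ?_
  have h1 := hu r
  have h2 := hu (-r)
  rw [decayWeight_neg] at h2
  simp only [norm_mul, norm_fourierKernel, mul_one]
  linarith

lemma norm_truncTransform_le {k r a : ℝ} (hk : k ≠ 0) (hr : 0 ≤ r) {u : ℝ → ℂ}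
    (hu : DecayC1 a u) : ‖truncTransform k r u‖ ≤ transformConst k * a := by
  obtain ⟨u', hc, hd, hb, hb'⟩ := hu
  have ha : 0 ≤ a := nonneg_of_mul_nonneg_left ((norm_nonneg _).trans (hb 0)) (decayWeight_pos 0)
  rw [truncTransform_eq_of_hasDerivAt hk r hd hc, norm_mul, norm_inv_I_mul, transformConst,
    mul_assoc]
  refine mul_le_mul_of_nonneg_left ?_ (by positivity)
  have h1 : ‖truncTransform k r u'‖ ≤ a * ∫ x, decayWeight x ^ 4 := by
    have hi : Integrable fun x => a * decayWeight x ^ 4 :=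
      integrable_decayWeight_pow_four.const_mul a
    refine (intervalIntegral.norm_integral_le_of_norm_le (g := fun x => a * decayWeight x ^ 4)
      (by linarith) (Eventually.of_forall fun x _ => by simpa using hb' x)
      hi.intervalIntegrable).trans ?_
    rw [← integral_const_mul, intervalIntegral.integral_of_le (by linarith)]
    exact setIntegral_le_integral hi (Eventually.of_forall fun x => by positivity)
  have h2 := norm_boundary_le hb k r
  have h3 : a * decayWeight r ≤ a * 1 := mul_le_mul_of_nonneg_left (decayWeight_le_one r) ha
  refine (norm_sub_le _ _).trans ?_
  linarith

lemma norm_integral_sub_intervalIntegral_le {g : ℝ → ℝ} {u : ℝ → ℂ} (hu : Continuous u)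
    (hg : Integrable g) (hb : ∀ x, ‖u x‖ ≤ g x) {r : ℝ} (hr : 0 ≤ r) :
    ‖(∫ x, u x) - ∫ x in (-r)..r, u x‖ ≤ (∫ x, g x) - ∫ x in (-r)..r, g x := by
  have hui : Integrable u := hg.mono' hu.aestronglyMeasurable (Eventually.of_forall hb)
  have hr' : -r ≤ r := by linarith
  rw [intervalIntegral.integral_of_le hr', intervalIntegral.integral_of_le hr',
    ← integral_add_compl measurableSet_Ioc hui, ← integral_add_compl measurableSet_Ioc hg,
    add_sub_cancel_left, add_sub_cancel_left]
  exact norm_integral_le_of_norm_le hg.integrableOn (Eventually.of_forall hb)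

/-- Both truncations are compared with the absolutely convergent integral `(ik)⁻¹ ∫ u' e^{-ikx}`.
The boundary terms and the tail of `∫ w⁴` are the two parts of `transformTail`. -/
lemma norm_truncTransform_sub_le {k r s a : ℝ} (hk : k ≠ 0) (hr : 0 ≤ r) (hs : 0 ≤ s)
    {u : ℝ → ℂ} (hu : DecayC1 a u) :
    ‖truncTransform k r u - truncTransform k s u‖
      ≤ (transformTail k r + transformTail k s) * a := by
  obtain ⟨u', hc, hd, hb, hb'⟩ := hu
  have key : ∀ t, 0 ≤ t →
      ‖truncTransform k t u - (Complex.I * k)⁻¹ * ∫ x, u' x * fourierKernel k x‖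
        ≤ transformTail k t * a := by
    intro t ht
    have h1 := norm_integral_sub_intervalIntegral_le (u := fun x => u' x * fourierKernel k x)
      (by fun_prop) (integrable_decayWeight_pow_four.const_mul a) (by simpa using hb') ht
    rw [integral_const_mul, intervalIntegral.integral_const_mul] at h1
    rw [truncTransform_eq_of_hasDerivAt hk t hd hc, ← mul_sub, norm_mul, norm_inv_I_mul,
      transformTail, mul_assoc]
    refine mul_le_mul_of_nonneg_left ?_ (by positivity)
    have h2 := norm_boundary_le hb k t
    rw [norm_sub_rev] at h1
    have h3 : truncTransform k t u' - (u t * fourierKernel k t - u (-t) * fourierKernel k (-t))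
        - ∫ x, u' x * fourierKernel k x
      = (truncTransform k t u' - ∫ x, u' x * fourierKernel k x)
        - (u t * fourierKernel k t - u (-t) * fourierKernel k (-t)) := by ring
    rw [h3]
    refine (norm_sub_le _ _).trans ?_
    rw [truncTransform]
    linarith
  have h := norm_sub_le_norm_sub_add_norm_sub (truncTransform k r u)
    ((Complex.I * k)⁻¹ * ∫ x, u' x * fourierKernel k x) (truncTransform k s u)
  have h1 := key r hr
  have h2 := key s hs
  rw [norm_sub_rev] at h2
  linarith

/-! ### Functionals on functions of one variable, applied to functions with parameters -/

/-- A functional which is bounded by `m` on `DecayC1 1`, which preserves continuity in parameters,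
and which commutes with the derivative in a parameter. -/
structure TransformBound (m : ℝ) (T : (ℝ → ℂ) → ℂ) : Prop where
  norm_le : ∀ {a : ℝ} {u : ℝ → ℂ}, DecayC1 a u → ‖T u‖ ≤ m * a
  continuous₁ : ∀ {g : ℝ → ℝ → ℂ}, Continuous (fun p : ℝ × ℝ => g p.1 p.2) →
    Continuous fun y => T fun x => g x y
  continuous₂ : ∀ {g : ℝ → ℝ → ℝ → ℂ}, Continuous (fun p : ℝ × ℝ × ℝ => g p.1 p.2.1 p.2.2) →
    Continuous fun p : ℝ × ℝ => T fun x => g x p.1 p.2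
  hasDerivAt : ∀ {g g' : ℝ → ℝ → ℂ} {K : ℝ}, Continuous (fun p : ℝ × ℝ => g p.1 p.2) →
    Continuous (fun p : ℝ × ℝ => g' p.1 p.2) → (∀ x y, HasDerivAt (g x) (g' x y) y) →
    (∀ x y, ‖g' x y‖ ≤ K) → ∀ y, HasDerivAt (fun y => T fun x => g x y) (T fun x => g' x y) y

lemma transformBound_truncTransform {k r : ℝ} (hk : k ≠ 0) (hr : 0 ≤ r) :
    TransformBound (transformConst k) (truncTransform k r) where
  norm_le := norm_truncTransform_le hk hr
  continuous₁ {g} hg := by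
    refine intervalIntegral.continuous_parametric_intervalIntegral_of_continuous' (μ := volume)
      (f := fun y x => g x y * fourierKernel k x) ?_ (-r) r
    have : Continuous fun p : ℝ × ℝ => g p.2 p.1 := hg.comp continuous_swap
    exact this.mul (by fun_prop)
  continuous₂ {g} hg := by
    refine intervalIntegral.continuous_parametric_intervalIntegral_of_continuous' (μ := volume)
      (f := fun (p : ℝ × ℝ) x => g x p.1 p.2 * fourierKernel k x) ?_ (-r) r
    have : Continuous fun p : (ℝ × ℝ) × ℝ => g p.2 p.1.1 p.1.2 :=
      hg.comp (g := fun p : ℝ × ℝ × ℝ => g p.1 p.2.1 p.2.2)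
      (f := fun p : (ℝ × ℝ) × ℝ => (p.2, p.1.1, p.1.2)) (by fun_prop)
    exact this.mul (by fun_prop)
  hasDerivAt {g g' K} hg hg' hd hK y := by
    have c : ∀ y, Continuous fun x => g x y := fun y =>
      hg.comp (f := fun x : ℝ => (x, y)) (by fun_prop)
    have c' : ∀ y, Continuous fun x => g' x y := fun y =>
      hg'.comp (f := fun x : ℝ => (x, y)) (by fun_prop)
    refine (intervalIntegral.hasDerivAt_integral_of_dominated_loc_of_deriv_le (μ := volume)
      (F := fun y x => g x y * fourierKernel k x) (F' := fun y x => g' x y * fourierKernel k x)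
      (bound := fun _ => K) (s := univ) univ_mem
      (Eventually.of_forall fun y => ((c y).mul (by fun_prop)).aestronglyMeasurable)
      (((c y).mul (by fun_prop)).intervalIntegrable _ _)
      ((c' y).mul (by fun_prop)).aestronglyMeasurable
      (Eventually.of_forall fun x _ y _ => by simpa using hK x y) (by simp)
      (Eventually.of_forall fun x _ y _ => (hd x y).mul_const _)).2

/-- Treating a difference of two truncations as a single operator, with small norm for large radii,
lets this smallness pass through the transforms in the remaining variables. -/
lemma transformBound_truncTransform_sub {k r s : ℝ} (hk : k ≠ 0) (hr : 0 ≤ r) (hs : 0 ≤ s) :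
    TransformBound (transformTail k r + transformTail k s)
      (fun u => truncTransform k r u - truncTransform k s u) where
  norm_le := norm_truncTransform_sub_le hk hr hs
  continuous₁ hg := ((transformBound_truncTransform hk hr).continuous₁ hg).sub
    ((transformBound_truncTransform hk hs).continuous₁ hg)
  continuous₂ hg := ((transformBound_truncTransform hk hr).continuous₂ hg).sub
    ((transformBound_truncTransform hk hs).continuous₂ hg)
  hasDerivAt hg hg' hd hK y := ((transformBound_truncTransform hk hr).hasDerivAt hg hg' hd hK y).sub
    ((transformBound_truncTransform hk hs).hasDerivAt hg hg' hd hK y)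

/-- Functions of two variables whose mixed derivatives of order at most one in each variable are
dominated by products of the bounds of `DecayC1`. -/
def DecayC2 (a : ℝ) (g : ℝ → ℝ → ℂ) : Prop :=
  Continuous (fun p : ℝ × ℝ => g p.1 p.2) ∧ ∃ g' : ℝ → ℝ → ℂ,
    Continuous (fun p : ℝ × ℝ => g' p.1 p.2) ∧ (∀ x y, HasDerivAt (g x) (g' x y) y) ∧
    (∀ y, DecayC1 (a * decayWeight y) fun x => g x y) ∧
    ∀ y, DecayC1 (a * decayWeight y ^ 4) fun x => g' x y

/-- Functions of three variables whose mixed derivatives of order at most one in each variable are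
dominated by products of the bounds of `DecayC1`. -/
def DecayC3 (a : ℝ) (g : ℝ → ℝ → ℝ → ℂ) : Prop :=
  Continuous (fun p : ℝ × ℝ × ℝ => g p.1 p.2.1 p.2.2) ∧ ∃ g' : ℝ → ℝ → ℝ → ℂ,
    Continuous (fun p : ℝ × ℝ × ℝ => g' p.1 p.2.1 p.2.2) ∧
    (∀ x y z, HasDerivAt (g x y) (g' x y z) z) ∧
    (∀ z, DecayC2 (a * decayWeight z) fun x y => g x y z) ∧
    ∀ z, DecayC2 (a * decayWeight z ^ 4) fun x y => g' x y z

lemma DecayC1.nonneg {a : ℝ} {u : ℝ → ℂ} (h : DecayC1 a u) : 0 ≤ a := by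
  obtain ⟨u', -, -, hb, -⟩ := h
  exact nonneg_of_mul_nonneg_left ((norm_nonneg _).trans (hb 0)) (decayWeight_pos 0)

lemma DecayC2.nonneg {a : ℝ} {g : ℝ → ℝ → ℂ} (h : DecayC2 a g) : 0 ≤ a := by
  obtain ⟨-, g', -, -, hb, -⟩ := h
  exact nonneg_of_mul_nonneg_left (hb 0).nonneg (decayWeight_pos 0)

lemma DecayC1.norm_le {a : ℝ} {u : ℝ → ℂ} (h : DecayC1 a u) (x : ℝ) : ‖u x‖ ≤ a := by
  have ha := h.nonneg
  obtain ⟨u', -, -, hb, -⟩ := h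
  exact (hb x).trans (mul_le_of_le_one_right ha (decayWeight_le_one x))

lemma DecayC2.norm_le {a : ℝ} {g : ℝ → ℝ → ℂ} (h : DecayC2 a g) (x y : ℝ) : ‖g x y‖ ≤ a := by
  have ha := h.nonneg
  obtain ⟨-, g', -, -, hb, -⟩ := h
  exact ((hb y).norm_le x).trans (mul_le_of_le_one_right ha (decayWeight_le_one y))

lemma decayWeight_pow_le_one (x : ℝ) (n : ℕ) : decayWeight x ^ n ≤ 1 :=
  pow_le_one₀ (decayWeight_nonneg x) (decayWeight_le_one x)

/-- `T` acts in `x` alone, so it commutes with `∂/∂y`, and the slices of `g` and `g'` already carry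
the weights `w(y)` and `w(y)⁴`. One variable is removed at the cost of a factor `m`. -/
lemma DecayC2.transform {a m : ℝ} {g : ℝ → ℝ → ℂ} {T : (ℝ → ℂ) → ℂ} (hT : TransformBound m T)
    (h : DecayC2 a g) : DecayC1 (m * a) fun y => T fun x => g x y := by
  have ha := h.nonneg
  obtain ⟨hc, g', hc', hd, hb, hb'⟩ := h
  refine ⟨fun y => T fun x => g' x y, hT.continuous₁ hc', hT.hasDerivAt (K := a) hc hc' hd ?_,
    fun y => ?_, fun y => ?_⟩
  · exact fun x y => ((hb' y).norm_le x).trans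
      (mul_le_of_le_one_right ha (decayWeight_pow_le_one y 4))
  · rw [mul_assoc]; exact hT.norm_le (hb y)
  · rw [mul_assoc]; exact hT.norm_le (hb' y)

lemma DecayC3.transform {a m : ℝ} {g : ℝ → ℝ → ℝ → ℂ} {T : (ℝ → ℂ) → ℂ}
    (hT : TransformBound m T) (h : DecayC3 a g) :
    DecayC2 (m * a) fun y z => T fun x => g x y z := by
  obtain ⟨hc, g', hc', hd, hb, hb'⟩ := h
  have ha : 0 ≤ a := nonneg_of_mul_nonneg_left (hb 0).nonneg (decayWeight_pos 0)
  refine ⟨hT.continuous₂ hc, fun y z => T fun x => g' x y z, hT.continuous₂ hc', fun y z => ?_,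
    fun z => ?_, fun z => ?_⟩
  · refine hT.hasDerivAt (g := fun x z => g x y z) (g' := fun x z => g' x y z) (K := a) ?_ ?_
      (fun x z => hd x y z) (fun x z => ((hb' z).norm_le x y).trans
      (mul_le_of_le_one_right ha (decayWeight_pow_le_one z 4))) z
    · exact hc.comp (f := fun p : ℝ × ℝ => (p.1, y, p.2)) (by fun_prop)
    · exact hc'.comp (f := fun p : ℝ × ℝ => (p.1, y, p.2)) (by fun_prop)
  · rw [mul_assoc]; exact (hb z).transform hT
  · rw [mul_assoc]; exact (hb' z).transform hT

/-! ### Limits -/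

/-- The rate comes from letting `q` run to the limit in the Cauchy estimate. It is kept because it
later gives convergence uniform in the variables not yet transformed. -/
lemma exists_tendsto_of_norm_sub_le {ι : Type*} {l : Filter ι} [l.NeBot] {u : ι → ℂ} {e : ι → ℝ}
    {S : Set ι} (hS : S ∈ l) (he : Tendsto e l (𝓝 0))
    (h : ∀ p ∈ S, ∀ q ∈ S, ‖u p - u q‖ ≤ e p + e q) :
    ∃ ℓ, Tendsto u l (𝓝 ℓ) ∧ ∀ p ∈ S, ‖u p - ℓ‖ ≤ e p := by
  have hc : Cauchy (map u l) := by
    refine Metric.cauchy_iff.2 ⟨inferInstance, fun ε hε => ?_⟩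
    have h1 : {p | e p < ε / 2} ∈ l := he.eventually_lt_const (by linarith)
    refine ⟨u '' (S ∩ {p | e p < ε / 2}), image_mem_map (inter_mem hS h1), ?_⟩
    rintro _ ⟨p, ⟨hp, hp'⟩, rfl⟩ _ ⟨q, ⟨hq, hq'⟩, rfl⟩
    rw [dist_eq_norm]
    have := h p hp q hq
    rw [mem_ofPred_eq] at hp' hq'
    linarith
  obtain ⟨ℓ, hℓ⟩ := CompleteSpace.complete hc
  refine ⟨ℓ, hℓ, fun p hp => ?_⟩
  have h1 : Tendsto (fun q => ‖u p - u q‖) l (𝓝 ‖u p - ℓ‖) :=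
    (Tendsto.const_sub (u p) hℓ).norm
  have h2 : Tendsto (fun q => e p + e q) l (𝓝 (e p)) := by simpa using he.const_add (e p)
  exact le_of_tendsto_of_tendsto h1 h2 (by filter_upwards [hS] with q hq using h p hp q hq)

/-- The joint limit forces the inner limits to approach it, so an iterated limit serves to identify
its value. -/
lemma tendsto_prod_of_iterated {ι κ : Type*} {l : Filter ι} {l' : Filter κ} [l.NeBot] [l'.NeBot]
    {u : ι × κ → ℂ} {v : ι → ℂ} {ℓ m : ℂ} (hu : Tendsto u (l ×ˢ l') (𝓝 ℓ))
    (hv : ∀ᶠ i in l, Tendsto (fun j => u (i, j)) l' (𝓝 (v i))) (hm : Tendsto v l (𝓝 m)) :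
    Tendsto u (l ×ˢ l') (𝓝 m) := by
  have h : Tendsto v l (𝓝 ℓ) := by
    refine Metric.tendsto_nhds.2 fun ε hε => ?_
    have h1 := (Metric.tendsto_nhds.1 hu (ε / 2) (by linarith)).curry
    filter_upwards [h1, hv] with i hi hi'
    have h2 : dist (v i) ℓ ≤ ε / 2 :=
      le_of_tendsto (hi'.dist tendsto_const_nhds) (hi.mono fun j hj => hj.le)
    linarith
  rwa [tendsto_nhds_unique hm h]

/-- Uniform convergence on a fixed compact interval. For the limit `ψ` only integrability against
the kernel is assumed, so no continuity of an improper transform has to be proved. -/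
lemma tendsto_truncTransform_of_norm_sub_le {ι : Type*} {l : Filter ι} {φ : ι → ℝ → ℂ}
    {ψ : ℝ → ℂ} {e : ι → ℝ} (k : ℝ) {r : ℝ} (hφ : ∀ᶠ i in l, Continuous (φ i))
    (hψ : Integrable fun x => ψ x * fourierKernel k x) (he : Tendsto e l (𝓝 0))
    (h : ∀ᶠ i in l, ∀ x, ‖φ i x - ψ x‖ ≤ e i) :
    Tendsto (fun i => truncTransform k r (φ i)) l (𝓝 (truncTransform k r ψ)) := by
  rw [tendsto_iff_norm_sub_tendsto_zero]
  refine squeeze_zero' (g := fun i => e i * |r - -r|) (Eventually.of_forall fun i => norm_nonneg _)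
    ?_ (by simpa using he.mul_const |r - -r|)
  filter_upwards [hφ, h] with i hi hi'
  rw [truncTransform, truncTransform, ← intervalIntegral.integral_sub
    (Continuous.intervalIntegrable (by fun_prop) _ _) hψ.intervalIntegrable]
  refine intervalIntegral.norm_integral_le_of_norm_le_const fun x _ => ?_
  rw [← sub_mul, norm_mul, norm_fourierKernel, mul_one]
  exact hi' x

lemma tendsto_truncTransform_integral {k : ℝ} {u : ℝ → ℂ}
    (hu : Integrable fun x => u x * fourierKernel k x) :
    Tendsto (fun r => truncTransform k r u) atTop (𝓝 (∫ x, u x * fourierKernel k x)) :=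
  intervalIntegral_tendsto_integral hu tendsto_neg_atTop_atBot tendsto_id

/-- The conditionally convergent Fourier transform `lim_{r → ∞} ∫_{-r}^{r} u(x) e^{-ikx} dx`. -/
noncomputable def improperTransform (k : ℝ) (u : ℝ → ℂ) : ℂ :=
  limUnder atTop fun r => truncTransform k r u

lemma DecayC1.tendsto_truncTransform_and {k a : ℝ} (hk : k ≠ 0) {u : ℝ → ℂ} (hu : DecayC1 a u) :
    Tendsto (fun r => truncTransform k r u) atTop (𝓝 (improperTransform k u)) ∧
      ∀ r, 0 ≤ r → ‖truncTransform k r u - improperTransform k u‖ ≤ transformTail k r * a := by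
  obtain ⟨ℓ, hℓ, hb⟩ := exists_tendsto_of_norm_sub_le (l := atTop)
    (u := fun r => truncTransform k r u) (e := fun r => transformTail k r * a) (Ici_mem_atTop 0)
    (by simpa using (tendsto_transformTail k).mul_const a)
    (fun p hp q hq => by rw [← add_mul]; exact norm_truncTransform_sub_le hk hp hq hu)
  have h : improperTransform k u = ℓ := hℓ.limUnder_eq
  rw [h]
  exact ⟨hℓ, hb⟩

lemma DecayC1.tendsto_truncTransform {k a : ℝ} (hk : k ≠ 0) {u : ℝ → ℂ} (hu : DecayC1 a u) :
    Tendsto (fun r => truncTransform k r u) atTop (𝓝 (improperTransform k u)) :=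
  (hu.tendsto_truncTransform_and hk).1

lemma DecayC1.norm_improperTransform_le {k a : ℝ} (hk : k ≠ 0) {u : ℝ → ℂ} (hu : DecayC1 a u) :
    ‖improperTransform k u‖ ≤ transformConst k * a := by
  refine le_of_tendsto (hu.tendsto_truncTransform hk).norm ?_
  filter_upwards [eventually_ge_atTop 0] with r hr using norm_truncTransform_le hk hr hu

lemma DecayC1.tendsto_zero {a : ℝ} {u : ℝ → ℂ} (hu : DecayC1 a u) :
    Tendsto u atTop (𝓝 0) ∧ Tendsto (fun x => u (-x)) atTop (𝓝 0) := by
  obtain ⟨u', -, -, hb, -⟩ := hu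
  have h : Tendsto (fun x => a * decayWeight x) atTop (𝓝 0) := by
    simpa using tendsto_decayWeight.const_mul a
  exact ⟨squeeze_zero_norm hb h,
    squeeze_zero_norm (fun x => by simpa [decayWeight_neg] using hb (-x)) h⟩

lemma DecayC1.improperTransform_eq {k a a' : ℝ} (hk : k ≠ 0) {u u' : ℝ → ℂ} (hu : DecayC1 a u)
    (hu' : DecayC1 a' u') (hd : ∀ x, HasDerivAt u (u' x) x) :
    improperTransform k u = (Complex.I * k)⁻¹ * improperTransform k u' := by
  have kernel : ∀ {v : ℝ → ℂ} {w : ℝ → ℝ}, Tendsto v atTop (𝓝 0) →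
      Tendsto (fun r => v r * fourierKernel k (w r)) atTop (𝓝 0) := fun hv =>
    squeeze_zero_norm (fun r => by simp) (tendsto_zero_iff_norm_tendsto_zero.1 hv)
  have h1 := ((hu'.tendsto_truncTransform hk).sub
    ((kernel (w := id) hu.tendsto_zero.1).sub
      (kernel (w := fun r => -r) hu.tendsto_zero.2))).const_mul (Complex.I * (k : ℂ))⁻¹
  rw [sub_zero, sub_zero] at h1
  refine tendsto_nhds_unique (hu.tendsto_truncTransform hk) (h1.congr fun r => ?_)
  exact (truncTransform_eq_of_hasDerivAt hk r hd hu'.continuous).symm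

/-! ### Transforms of functions of two variables -/

/-- The double truncated transform, over `[-q.2, q.2]` in `x` and `[-q.1, q.1]` in `y`. -/
noncomputable def truncTransform₂ (k₁ k₂ : ℝ) (q : ℝ × ℝ) (g : ℝ → ℝ → ℂ) : ℂ :=
  truncTransform k₂ q.1 fun y => truncTransform k₁ q.2 fun x => g x y

/-- A bound for the error of `truncTransform₂` on `DecayC2 1`. -/
noncomputable def transformTail₂ (k₁ k₂ : ℝ) (q : ℝ × ℝ) : ℝ :=
  transformTail k₂ q.1 * transformConst k₁ + transformConst k₂ * transformTail k₁ q.2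

lemma tendsto_transformTail₂ (k₁ k₂ : ℝ) :
    Tendsto (transformTail₂ k₁ k₂) (atTop ×ˢ atTop) (𝓝 0) := by
  have h := (((tendsto_transformTail k₂).comp (tendsto_fst (f := atTop) (g := atTop))).mul_const
    (transformConst k₁)).add (((tendsto_transformTail k₁).comp
      (tendsto_snd (f := atTop) (g := atTop))).const_mul (transformConst k₂))
  simp only [zero_mul, mul_zero, add_zero] at h
  exact h

section Truncated

variable {k₁ k₂ k₃ : ℝ}

lemma DecayC2.norm_truncTransform₂_sub_le (h₁ : k₁ ≠ 0) (h₂ : k₂ ≠ 0) {a : ℝ} {g : ℝ → ℝ → ℂ}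
    (hg : DecayC2 a g) {p q : ℝ × ℝ} (hp : 0 ≤ p.1 ∧ 0 ≤ p.2) (hq : 0 ≤ q.1 ∧ 0 ≤ q.2) :
    ‖truncTransform₂ k₁ k₂ p g - truncTransform₂ k₁ k₂ q g‖
      ≤ transformTail₂ k₁ k₂ p * a + transformTail₂ k₁ k₂ q * a := by
  have hP := hg.transform (transformBound_truncTransform h₁ hp.2)
  have hQ := hg.transform (transformBound_truncTransform h₁ hq.2)
  have hD := hg.transform (transformBound_truncTransform_sub h₁ hp.2 hq.2)
  have e1 := norm_truncTransform_sub_le h₂ hp.1 hq.1 hP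
  have e2 := norm_truncTransform_le h₂ hq.1 hD
  rw [truncTransform_sub _ _ hP.continuous hQ.continuous] at e2
  -- The two rectangles are joined through one with the outer radius of `q` and the inner radius of
  -- `p`, so that one radius changes at a time.
  refine (norm_sub_le_norm_sub_add_norm_sub _
    (truncTransform k₂ q.1 fun y => truncTransform k₁ p.2 fun x => g x y) _).trans
    ((add_le_add e1 e2).trans (le_of_eq ?_))
  simp only [transformTail₂]
  ring

lemma DecayC2.norm_truncTransform₂_le (h₁ : k₁ ≠ 0) (h₂ : k₂ ≠ 0) {a : ℝ} {g : ℝ → ℝ → ℂ}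
    (hg : DecayC2 a g) {q : ℝ × ℝ} (hq : 0 ≤ q.1 ∧ 0 ≤ q.2) :
    ‖truncTransform₂ k₁ k₂ q g‖ ≤ transformConst k₂ * (transformConst k₁ * a) :=
  norm_truncTransform_le h₂ hq.1 (hg.transform (transformBound_truncTransform h₁ hq.2))

lemma quadrant_mem : {q : ℝ × ℝ | 0 ≤ q.1 ∧ 0 ≤ q.2} ∈ (atTop ×ˢ atTop : Filter (ℝ × ℝ)) :=
  (eventually_ge_atTop 0).prod_mk (eventually_ge_atTop 0)

lemma DecayC2.tendsto_truncTransform₂ (h₁ : k₁ ≠ 0) (h₂ : k₂ ≠ 0) {a : ℝ} {g : ℝ → ℝ → ℂ}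
    (hg : DecayC2 a g)
    (hi : Integrable fun y => improperTransform k₁ (fun x => g x y) * fourierKernel k₂ y) :
    Tendsto (fun q => truncTransform₂ k₁ k₂ q g) (atTop ×ˢ atTop)
        (𝓝 (∫ y, improperTransform k₁ (fun x => g x y) * fourierKernel k₂ y)) ∧
      ∀ q : ℝ × ℝ, 0 ≤ q.1 ∧ 0 ≤ q.2 →
        ‖truncTransform₂ k₁ k₂ q g
          - ∫ y, improperTransform k₁ (fun x => g x y) * fourierKernel k₂ y‖
            ≤ transformTail₂ k₁ k₂ q * a := by
  obtain ⟨ℓ, hℓ, hb⟩ := exists_tendsto_of_norm_sub_le (u := fun q => truncTransform₂ k₁ k₂ q g)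
    (e := fun q => transformTail₂ k₁ k₂ q * a) quadrant_mem
    (by simpa using (tendsto_transformTail₂ k₁ k₂).mul_const a)
    (fun p hp q hq => hg.norm_truncTransform₂_sub_le h₁ h₂ hp hq)
  have ha := hg.nonneg
  have h1 : ∀ y, DecayC1 (a * decayWeight y) fun x => g x y := by
    obtain ⟨-, g', -, -, h, -⟩ := hg
    exact h
  have key := tendsto_prod_of_iterated hℓ
    (v := fun r => truncTransform k₂ r fun y => improperTransform k₁ fun x => g x y) ?_
    (tendsto_truncTransform_integral hi)
  · obtain rfl := tendsto_nhds_unique hℓ key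
    exact ⟨hℓ, hb⟩
  · filter_upwards with r
    -- The absolute value allows the factor `w(y) ≤ 1` to be dropped whatever the sign of the tail,
    -- giving an error independent of `y`.
    refine tendsto_truncTransform_of_norm_sub_le (e := fun s => |transformTail k₁ s| * a) k₂ ?_ hi
      (by simpa using (tendsto_transformTail k₁).abs.mul_const a) ?_
    · filter_upwards [eventually_ge_atTop 0] with s hs
      exact (hg.transform (transformBound_truncTransform h₁ hs)).continuous
    · filter_upwards [eventually_ge_atTop 0] with s hs y
      refine (((h1 y).tendsto_truncTransform_and h₁).2 s hs).trans
        (mul_le_mul (le_abs_self _) (mul_le_of_le_one_right ha (decayWeight_le_one y))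
          (mul_nonneg ha (decayWeight_nonneg y)) (abs_nonneg _))

/-! ### Transforms of functions of three variables -/

lemma DecayC3.decayC2 {a : ℝ} {g : ℝ → ℝ → ℝ → ℂ} (hg : DecayC3 a g) (z : ℝ) :
    DecayC2 (a * decayWeight z) fun x y => g x y z := by
  obtain ⟨-, g', -, -, h, -⟩ := hg
  exact h z

lemma DecayC3.decayC1 {a : ℝ} {g : ℝ → ℝ → ℝ → ℂ} (hg : DecayC3 a g) (y z : ℝ) :
    DecayC1 (a * decayWeight z * decayWeight y) fun x => g x y z := by
  obtain ⟨-, g', -, -, h, -⟩ := hg.decayC2 z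
  exact h y

lemma DecayC3.nonneg {a : ℝ} {g : ℝ → ℝ → ℝ → ℂ} (hg : DecayC3 a g) : 0 ≤ a :=
  nonneg_of_mul_nonneg_left (hg.decayC2 0).nonneg (decayWeight_pos 0)

lemma integrable_mul_fourierKernel_section {k b : ℝ} (k' : ℝ) {g : ℝ → ℝ → ℝ → ℂ} {a : ℝ}
    (hk : k ≠ 0) (hg : DecayC3 a g)
    (hb : ∀ y z, ‖improperTransform k fun x => g x y z‖
      ≤ b * (decayWeight y ^ 4 * decayWeight z ^ 4)) (z : ℝ) :
    Integrable fun y => improperTransform k (fun x => g x y z) * fourierKernel k' y := by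
  refine Integrable.mono' ((integrable_decayWeight_pow_four.mul_const (decayWeight z ^ 4)).const_mul
    b) (AEStronglyMeasurable.mul ?_ (continuous_fourierKernel k').aestronglyMeasurable)
    (Eventually.of_forall fun y => by simpa using hb y z)
  -- Measurability of the improper transform: it is a pointwise limit, along integer radii, of
  -- continuous functions.
  refine aestronglyMeasurable_of_tendsto_ae atTop
    (f := fun (n : ℕ) y => truncTransform k n fun x => g x y z) (fun n => ?_)
    (Eventually.of_forall fun y =>
      ((hg.decayC1 y z).tendsto_truncTransform hk).comp tendsto_natCast_atTop_atTop)
  exact ((hg.decayC2 z).transform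
    (transformBound_truncTransform hk n.cast_nonneg)).continuous.aestronglyMeasurable

lemma integrable_mul_fourierKernel {k b : ℝ} (k' k'' : ℝ) {g : ℝ → ℝ → ℝ → ℂ} {a : ℝ}
    (hk : k ≠ 0) (hg : DecayC3 a g)
    (hb : ∀ y z, ‖improperTransform k fun x => g x y z‖
      ≤ b * (decayWeight y ^ 4 * decayWeight z ^ 4)) :
    Integrable fun p : ℝ × ℝ => improperTransform k (fun x => g x p.1 p.2) *
      fourierKernel k' p.1 * fourierKernel k'' p.2 := by
  refine Integrable.mono' ((integrable_decayWeight_pow_four.mul_prod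
    integrable_decayWeight_pow_four).const_mul b)
    (AEStronglyMeasurable.mul (AEStronglyMeasurable.mul ?_ ?_) ?_)
    (Eventually.of_forall fun p => by simpa using hb p.1 p.2)
  · refine aestronglyMeasurable_of_tendsto_ae atTop
      (f := fun (n : ℕ) (p : ℝ × ℝ) => truncTransform k n fun x => g x p.1 p.2) (fun n => ?_)
      (Eventually.of_forall fun p =>
        ((hg.decayC1 p.1 p.2).tendsto_truncTransform hk).comp tendsto_natCast_atTop_atTop)
    exact ((transformBound_truncTransform hk n.cast_nonneg).continuous₂ hg.1).aestronglyMeasurable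
  · exact Continuous.aestronglyMeasurable (by fun_prop)
  · exact Continuous.aestronglyMeasurable (by fun_prop)

/-- The triple truncated transform, over `[-q.2.2, q.2.2]` in `x`, `[-q.2.1, q.2.1]` in `y` and
`[-q.1, q.1]` in `z`. -/
noncomputable def truncTransform₃ (k₁ k₂ k₃ : ℝ) (q : ℝ × ℝ × ℝ) (g : ℝ → ℝ → ℝ → ℂ) : ℂ :=
  truncTransform k₃ q.1 fun z => truncTransform₂ k₁ k₂ q.2 fun x y => g x y z

lemma truncTransform₃_eq (q : ℝ × ℝ × ℝ) (g : ℝ → ℝ → ℝ → ℂ) :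
    truncTransform₃ k₁ k₂ k₃ q g = truncTransform₂ k₂ k₃ (q.1, q.2.1)
      fun y z => truncTransform k₁ q.2.2 fun x => g x y z := rfl

lemma DecayC3.norm_truncTransform₃_sub_le (h₁ : k₁ ≠ 0) (h₂ : k₂ ≠ 0) (h₃ : k₃ ≠ 0) {a : ℝ}
    {g : ℝ → ℝ → ℝ → ℂ} (hg : DecayC3 a g) {p q : ℝ × ℝ × ℝ}
    (hp : 0 ≤ p.1 ∧ 0 ≤ p.2.1 ∧ 0 ≤ p.2.2) (hq : 0 ≤ q.1 ∧ 0 ≤ q.2.1 ∧ 0 ≤ q.2.2) :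
    ‖truncTransform₃ k₁ k₂ k₃ p g - truncTransform₃ k₁ k₂ k₃ q g‖
      ≤ (transformTail₂ k₂ k₃ (p.1, p.2.1) * transformConst k₁
            + transformConst k₃ * transformConst k₂ * transformTail k₁ p.2.2) * a
        + (transformTail₂ k₂ k₃ (q.1, q.2.1) * transformConst k₁
            + transformConst k₃ * transformConst k₂ * transformTail k₁ q.2.2) * a := by
  have hP := hg.transform (transformBound_truncTransform h₁ hp.2.2)
  have hQ := hg.transform (transformBound_truncTransform h₁ hq.2.2)
  have hD := hg.transform (transformBound_truncTransform_sub h₁ hp.2.2 hq.2.2)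
  have e1 := hP.norm_truncTransform₂_sub_le h₂ h₃ (p := (p.1, p.2.1)) (q := (q.1, q.2.1))
    ⟨hp.1, hp.2.1⟩ ⟨hq.1, hq.2.1⟩
  have e2 := hD.norm_truncTransform₂_le h₂ h₃ (q := (q.1, q.2.1)) ⟨hq.1, hq.2.1⟩
  have sec : ∀ {G : ℝ → ℝ → ℂ}, Continuous (fun p : ℝ × ℝ => G p.1 p.2) → ∀ z,
      Continuous fun y => G y z := fun hG z => hG.comp (f := fun y : ℝ => (y, z)) (by fun_prop)
  have e3 : truncTransform₂ k₂ k₃ (q.1, q.2.1) (fun y z => (truncTransform k₁ p.2.2 fun x => g x y z)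
        - truncTransform k₁ q.2.2 fun x => g x y z)
      = truncTransform₂ k₂ k₃ (q.1, q.2.1) (fun y z => truncTransform k₁ p.2.2 fun x => g x y z)
        - truncTransform₂ k₂ k₃ (q.1, q.2.1)
            (fun y z => truncTransform k₁ q.2.2 fun x => g x y z) := by
    simp only [truncTransform₂]
    rw [← truncTransform_sub _ _
      (hP.transform (transformBound_truncTransform h₂ hq.2.1)).continuous
      (hQ.transform (transformBound_truncTransform h₂ hq.2.1)).continuous]
    congr 1; ext z
    exact truncTransform_sub _ _
      (sec (G := fun y z => truncTransform k₁ p.2.2 fun x => g x y z) hP.1 z)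
      (sec (G := fun y z => truncTransform k₁ q.2.2 fun x => g x y z) hQ.1 z)
  rw [e3] at e2
  simp only [truncTransform₃_eq]
  refine (norm_sub_le_norm_sub_add_norm_sub _
    (truncTransform₂ k₂ k₃ (q.1, q.2.1) fun y z => truncTransform k₁ p.2.2 fun x => g x y z)
    _).trans ((add_le_add e1 e2).trans (le_of_eq ?_))
  ring

/-- Existence of the limit is the Cauchy estimate. To find its value, the radii in `x` and `y` go to
infinity first with the radius in `z` fixed; the planar rate is uniform in `z`, so the limit passes
under the integral. -/
lemma DecayC3.tendsto_truncTransform₃ (h₁ : k₁ ≠ 0) (h₂ : k₂ ≠ 0) (h₃ : k₃ ≠ 0) {a b : ℝ}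
    {g : ℝ → ℝ → ℝ → ℂ} (hg : DecayC3 a g)
    (hb : ∀ y z, ‖improperTransform k₁ fun x => g x y z‖
      ≤ b * (decayWeight y ^ 4 * decayWeight z ^ 4)) :
    Tendsto (fun q => truncTransform₃ k₁ k₂ k₃ q g) (atTop ×ˢ atTop ×ˢ atTop)
      (𝓝 (∫ z, (∫ y, improperTransform k₁ (fun x => g x y z) * fourierKernel k₂ y) *
        fourierKernel k₃ z)) := by
  have hsec := integrable_mul_fourierKernel_section k₂ h₁ hg hb
  have hF : Integrable fun z =>
      (∫ y, improperTransform k₁ (fun x => g x y z) * fourierKernel k₂ y) * fourierKernel k₃ z := by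
    have h := (integrable_mul_fourierKernel k₂ k₃ h₁ hg hb).integral_prod_right
    simpa only [integral_mul_const] using h
  have ha := hg.nonneg
  have hS : {q : ℝ × ℝ × ℝ | 0 ≤ q.1 ∧ 0 ≤ q.2.1 ∧ 0 ≤ q.2.2}
      ∈ (atTop ×ˢ atTop ×ˢ atTop : Filter (ℝ × ℝ × ℝ)) :=
    (eventually_ge_atTop 0).prod_mk quadrant_mem
  have t1 : Tendsto (fun q : ℝ × ℝ × ℝ => (q.1, q.2.1)) (atTop ×ˢ atTop ×ˢ atTop)
      (atTop ×ˢ atTop) := tendsto_fst.prodMk (tendsto_fst.comp tendsto_snd)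
  have t2 : Tendsto (fun q : ℝ × ℝ × ℝ => q.2.2) (atTop ×ˢ atTop ×ˢ atTop) atTop :=
    tendsto_snd.comp tendsto_snd
  have he := (((((tendsto_transformTail₂ k₂ k₃).comp t1).mul_const (transformConst k₁)).add
    (((tendsto_transformTail k₁).comp t2).const_mul
      (transformConst k₃ * transformConst k₂))).mul_const a)
  simp only [zero_mul, mul_zero, add_zero] at he
  obtain ⟨ℓ, hℓ, -⟩ := exists_tendsto_of_norm_sub_le
    (u := fun q => truncTransform₃ k₁ k₂ k₃ q g) hS he
    (fun p hp q hq => hg.norm_truncTransform₃_sub_le h₁ h₂ h₃ hp hq)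
  refine tendsto_prod_of_iterated hℓ (v := fun r => truncTransform k₃ r fun z =>
    ∫ y, improperTransform k₁ (fun x => g x y z) * fourierKernel k₂ y) ?_
    (tendsto_truncTransform_integral hF)
  filter_upwards with r
  refine tendsto_truncTransform_of_norm_sub_le (e := fun q => |transformTail₂ k₁ k₂ q| * a) k₃ ?_ hF
    (by simpa using (tendsto_transformTail₂ k₁ k₂).abs.mul_const a) ?_
  · filter_upwards [quadrant_mem] with q hq
    exact ((hg.transform (transformBound_truncTransform h₁ hq.2)).transform
      (transformBound_truncTransform h₂ hq.1)).continuous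
  · filter_upwards [quadrant_mem] with q hq z
    exact (((hg.decayC2 z).tendsto_truncTransform₂ h₁ h₂ (hsec z)).2 q hq).trans
      (mul_le_mul (le_abs_self _) (mul_le_of_le_one_right ha (decayWeight_le_one z))
        (mul_nonneg ha (decayWeight_nonneg z)) (abs_nonneg _))

end Truncated

/-! ### Symbol estimates -/

/-- The weight `(1 + x² + y² + z²)^(-1/6)`. -/
noncomputable def decayWeight₃ (x y z : ℝ) : ℝ := (1 + x ^ 2 + y ^ 2 + z ^ 2) ^ (-(1 / 6) : ℝ)

lemma decayWeight₃_nonneg (x y z : ℝ) : 0 ≤ decayWeight₃ x y z := by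
  unfold decayWeight₃; positivity

/-- The joint weight is at most the weight of each single variable, so its factors may be
distributed at will. -/
lemma decayWeight₃_pow_le (x y z : ℝ) (a b c : ℕ) :
    decayWeight₃ x y z ^ (a + b + c) ≤ decayWeight x ^ a * decayWeight y ^ b * decayWeight z ^ c := by
  have h : ∀ t, t ^ 2 ≤ x ^ 2 + y ^ 2 + z ^ 2 → decayWeight₃ x y z ≤ decayWeight t := fun t ht =>
    Real.rpow_le_rpow_of_nonpos (by positivity) (by linarith) (by norm_num)
  have h0 := decayWeight₃_nonneg x y z
  have hx := h x (by nlinarith [sq_nonneg y, sq_nonneg z])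
  have hy := h y (by nlinarith [sq_nonneg x, sq_nonneg z])
  have hz := h z (by nlinarith [sq_nonneg x, sq_nonneg y])
  have := decayWeight_nonneg x
  have := decayWeight_nonneg y
  rw [pow_add, pow_add]
  gcongr

/-- The derivatives of `f` of order at most `d` are continuous, and those of order `i` are bounded
by `C (1 + x² + y² + z²)^(-(m + i)/2)`. -/
def SymbolBound (C : ℝ) : ℕ → ℕ → (ℝ → ℝ → ℝ → ℂ) → Prop
  | 0, m, f => Continuous (fun p : ℝ × ℝ × ℝ => f p.1 p.2.1 p.2.2) ∧
      ∀ x y z, ‖f x y z‖ ≤ C * decayWeight₃ x y z ^ (3 * m)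
  | d + 1, m, f => Continuous (fun p : ℝ × ℝ × ℝ => f p.1 p.2.1 p.2.2) ∧
      (∀ x y z, ‖f x y z‖ ≤ C * decayWeight₃ x y z ^ (3 * m)) ∧
      (∃ g, (∀ x y z, HasDerivAt (fun x => f x y z) (g x y z) x) ∧ SymbolBound C d (m + 1) g) ∧
      (∃ g, (∀ x y z, HasDerivAt (fun y => f x y z) (g x y z) y) ∧ SymbolBound C d (m + 1) g) ∧
      ∃ g, (∀ x y z, HasDerivAt (fun z => f x y z) (g x y z) z) ∧ SymbolBound C d (m + 1) g

namespace SymbolBound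

variable {C : ℝ}

lemma continuous {d m : ℕ} {f : ℝ → ℝ → ℝ → ℂ} (h : SymbolBound C d m f) :
    Continuous (fun p : ℝ × ℝ × ℝ => f p.1 p.2.1 p.2.2) := by
  cases d <;> exact h.1

lemma norm_le {d m : ℕ} {f : ℝ → ℝ → ℝ → ℂ} (h : SymbolBound C d m f) (x y z : ℝ) :
    ‖f x y z‖ ≤ C * decayWeight₃ x y z ^ (3 * m) := by
  cases d with
  | zero => exact h.2 x y z
  | succ d => exact h.2.1 x y z

lemma const_nonneg {d m : ℕ} {f : ℝ → ℝ → ℝ → ℂ} (h : SymbolBound C d m f) : 0 ≤ C :=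
  nonneg_of_mul_nonneg_left ((norm_nonneg _).trans (h.norm_le 0 0 0))
    (by simp [decayWeight₃])

/-- The definition supplies derivatives in all three directions at each stage, so permuting
variables only permutes these witnesses; mixed derivatives need not commute. -/
lemma swap_xy {d m : ℕ} {f : ℝ → ℝ → ℝ → ℂ} (h : SymbolBound C d m f) :
    SymbolBound C d m fun y x z => f x y z := by
  induction d generalizing m f with
  | zero =>
    refine ⟨h.1.comp (f := fun p : ℝ × ℝ × ℝ => (p.2.1, p.1, p.2.2)) (by fun_prop),
      fun y x z => ?_⟩
    simpa only [decayWeight₃, add_right_comm 1 (y ^ 2)] using h.2 x y z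
  | succ d ih =>
    obtain ⟨hc, hb, ⟨g₁, d₁, s₁⟩, ⟨g₂, d₂, s₂⟩, g₃, d₃, s₃⟩ := h
    refine ⟨hc.comp (f := fun p : ℝ × ℝ × ℝ => (p.2.1, p.1, p.2.2)) (by fun_prop),
      fun y x z => ?_, ⟨_, fun y x z => d₂ x y z, ih s₂⟩, ⟨_, fun y x z => d₁ x y z, ih s₁⟩,
      _, fun y x z => d₃ x y z, ih s₃⟩
    simpa only [decayWeight₃, add_right_comm 1 (y ^ 2)] using hb x y z

lemma swap_yz {d m : ℕ} {f : ℝ → ℝ → ℝ → ℂ} (h : SymbolBound C d m f) :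
    SymbolBound C d m fun x z y => f x y z := by
  induction d generalizing m f with
  | zero =>
    refine ⟨h.1.comp (f := fun p : ℝ × ℝ × ℝ => (p.1, p.2.2, p.2.1)) (by fun_prop),
      fun x z y => ?_⟩
    simpa only [decayWeight₃, add_right_comm _ (z ^ 2)] using h.2 x y z
  | succ d ih =>
    obtain ⟨hc, hb, ⟨g₁, d₁, s₁⟩, ⟨g₂, d₂, s₂⟩, g₃, d₃, s₃⟩ := h
    refine ⟨hc.comp (f := fun p : ℝ × ℝ × ℝ => (p.1, p.2.2, p.2.1)) (by fun_prop),
      fun x z y => ?_, ⟨_, fun x z y => d₁ x y z, ih s₁⟩, ⟨_, fun x z y => d₃ x y z, ih s₃⟩,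
      _, fun x z y => d₂ x y z, ih s₂⟩
    simpa only [decayWeight₃, add_right_comm _ (z ^ 2)] using hb x y z

lemma norm_le_mul {d m a b c : ℕ} {f : ℝ → ℝ → ℝ → ℂ} (h : SymbolBound C d m f)
    (habc : a + b + c = 3 * m) (x y z : ℝ) :
    ‖f x y z‖ ≤ C * decayWeight z ^ c * decayWeight y ^ b * decayWeight x ^ a := by
  have h1 := h.norm_le x y z
  rw [← habc] at h1
  refine h1.trans ((mul_le_mul_of_nonneg_left (decayWeight₃_pow_le x y z a b c)
    h.const_nonneg).trans (le_of_eq (by ring)))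

/-- Of the `3m` factors one goes to `x`, the others to `y` and `z`. Differentiating in `x` yields
three more, all given to `x`, which explains the power four. -/
lemma decayC1 {d m b c : ℕ} {f : ℝ → ℝ → ℝ → ℂ} (h : SymbolBound C (d + 1) m f)
    (hbc : 1 + b + c = 3 * m) (y z : ℝ) :
    DecayC1 (C * decayWeight z ^ c * decayWeight y ^ b) fun x => f x y z := by
  obtain ⟨g, hd, hg⟩ := h.2.2.1
  refine ⟨fun x => g x y z, ?_, fun x => hd x y z, fun x => ?_,
    fun x => hg.norm_le_mul (by omega) x y z⟩
  · exact hg.continuous.comp (f := fun x : ℝ => (x, y, z)) (by fun_prop)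
  · simpa using h.norm_le_mul hbc x y z

lemma decayC2 {d m c : ℕ} {f : ℝ → ℝ → ℝ → ℂ} (h : SymbolBound C (d + 2) m f)
    (hc : 2 + c = 3 * m) (z : ℝ) :
    DecayC2 (C * decayWeight z ^ c) fun x y => f x y z := by
  obtain ⟨g, hd, hg⟩ := h.2.2.2.1
  refine ⟨?_, fun x y => g x y z, ?_, fun x y => hd x y z, fun y => ?_,
    fun y => hg.decayC1 (by omega) y z⟩
  · exact h.continuous.comp (f := fun p : ℝ × ℝ => (p.1, p.2, z)) (by fun_prop)
  · exact hg.continuous.comp (f := fun p : ℝ × ℝ => (p.1, p.2, z)) (by fun_prop)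
  · simpa using h.decayC1 (b := 1) (c := c) (by omega) y z

lemma decayC3 {d : ℕ} {f : ℝ → ℝ → ℝ → ℂ} (h : SymbolBound C (d + 3) 1 f) : DecayC3 C f := by
  obtain ⟨g, hd, hg⟩ := h.2.2.2.2
  refine ⟨h.continuous, g, hg.continuous, hd, fun z => ?_, fun z => hg.decayC2 (by omega) z⟩
  simpa using h.decayC2 (c := 1) (by omega) z

/-- Two integrations by parts in `x` reach a derivative bounded with nine weight factors, split as
`1 + 4 + 4`. Bounding its transform uses one further derivative, hence the depth three. -/
lemma norm_improperTransform_le {k : ℝ} (hk : k ≠ 0) {f : ℝ → ℝ → ℝ → ℂ}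
    (h : SymbolBound C 3 1 f) (y z : ℝ) :
    ‖improperTransform k fun x => f x y z‖
      ≤ |k|⁻¹ * |k|⁻¹ * transformConst k * C * (decayWeight y ^ 4 * decayWeight z ^ 4) := by
  obtain ⟨f₁, hd₁, h₁⟩ := h.2.2.1
  obtain ⟨f₂, hd₂, h₂⟩ := h₁.2.2.1
  have e₀ := h.decayC1 (b := 1) (c := 1) (by omega) y z
  have e₁ := h₁.decayC1 (b := 1) (c := 4) (by omega) y z
  have e₂ := h₂.decayC1 (b := 4) (c := 4) (by omega) y z
  rw [e₀.improperTransform_eq hk e₁ fun x => hd₁ x y z,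
    e₁.improperTransform_eq hk e₂ fun x => hd₂ x y z, norm_mul, norm_mul, norm_inv_I_mul]
  have h3 := mul_le_mul_of_nonneg_left (e₂.norm_improperTransform_le hk)
    (by positivity : 0 ≤ |k|⁻¹ * |k|⁻¹)
  exact (le_of_eq (by ring)).trans (h3.trans (le_of_eq (by ring)))

end SymbolBound

/-! ### Partial derivatives -/

lemma decayWeight₃_pow_three (x y z : ℝ) :
    decayWeight₃ x y z ^ 3 = (√(1 + x ^ 2 + y ^ 2 + z ^ 2))⁻¹ := by
  rw [decayWeight₃, ← Real.rpow_mul_natCast (by positivity), Real.sqrt_eq_rpow,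
    ← Real.rpow_neg (by positivity)]
  norm_num

lemma IsOfDecrease₃.exists_le {n : ℕ} {g : ℝ → ℝ → ℝ → ℝ} (hg : IsOfDecrease₃ n ∅ g)
    (hc : Continuous fun p : ℝ × ℝ × ℝ => g p.1 p.2.1 p.2.2) :
    ∃ C, 0 ≤ C ∧ ∀ x y z, |g x y z| ≤ C * decayWeight₃ x y z ^ (3 * n) := by
  obtain ⟨C, hC, hb⟩ := hg
  obtain ⟨K, hK⟩ := (isCompact_closedBall (0 : ℝ × ℝ × ℝ) 1).exists_bound_of_continuousOn
    hc.continuousOn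
  have hK0 : 0 ≤ K := (norm_nonneg _).trans (hK 0 (by simp))
  -- `K` bounds `g` on the unit ball of the maximum norm, which contains the Euclidean one. The
  -- factor `2` serves both regions: `√(1 + |p|²) ≤ 2|p|` outside the Euclidean ball, and `√(1 +
  -- |p|²) ≤ 2` inside.
  refine ⟨(C + K) * 2 ^ n, by positivity, fun x y z => ?_⟩
  have hs : 0 < √(1 + x ^ 2 + y ^ 2 + z ^ 2) := by positivity
  rw [pow_mul, decayWeight₃_pow_three, mul_assoc, ← mul_pow, ← div_eq_mul_inv]
  rcases lt_or_ge 1 (√(x ^ 2 + y ^ 2 + z ^ 2)) with h | h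
  · have h1 := hb x y z (by simp) h
    have h2 : (√(x ^ 2 + y ^ 2 + z ^ 2))⁻¹ ≤ 2 / √(1 + x ^ 2 + y ^ 2 + z ^ 2) := by
      have h3 : √(1 + x ^ 2 + y ^ 2 + z ^ 2) ≤ 2 * √(x ^ 2 + y ^ 2 + z ^ 2) := by
        rw [Real.sqrt_le_left (by positivity), mul_pow, Real.sq_sqrt (by positivity)]
        have h4 : 1 < x ^ 2 + y ^ 2 + z ^ 2 := by
          rw [Real.lt_sqrt (by norm_num)] at h; linarith
        linarith
      rw [inv_eq_one_div, div_le_div_iff₀ (by linarith) hs]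
      linarith
    rw [div_eq_mul_inv, ← inv_pow] at h1
    refine h1.trans (mul_le_mul (by linarith) (by gcongr) (by positivity) (by positivity))
  · have h1 : x ^ 2 + y ^ 2 + z ^ 2 ≤ 1 := by
      rw [Real.sqrt_le_left (by norm_num)] at h; linarith
    have h2 : ∀ t, t ^ 2 ≤ x ^ 2 + y ^ 2 + z ^ 2 → |t| ≤ 1 := fun t ht =>
      abs_le_one_iff_mul_self_le_one.2 (by nlinarith)
    have h3 : |g x y z| ≤ K := by
      refine hK (x, y, z) ?_
      rw [mem_closedBall_zero_iff]
      exact max_le (h2 x (by nlinarith [sq_nonneg y, sq_nonneg z]))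
        (max_le (h2 y (by nlinarith [sq_nonneg x, sq_nonneg z]))
          (h2 z (by nlinarith [sq_nonneg x, sq_nonneg y])))
    have h4 : 1 ≤ 2 / √(1 + x ^ 2 + y ^ 2 + z ^ 2) := by
      rw [one_le_div hs, Real.sqrt_le_left (by norm_num)]
      linarith
    have h5 := one_le_pow₀ (n := n) h4
    nlinarith

section DirectionalDerivative

variable {E : Type*} [NormedAddCommGroup E] [NormedSpace ℝ E]

/-- The derivative of `g` in the direction `v`. -/
noncomputable def dirDeriv (v : E) (g : E → ℝ) : E → ℝ := fun p => fderiv ℝ g p v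

lemma contDiff_dirDeriv {g : E → ℝ} (hg : ContDiff ℝ ∞ g) (v : E) : ContDiff ℝ ∞ (dirDeriv v g) :=
  (hg.fderiv_right (m := ∞) (by simp)).clm_apply contDiff_const

lemma contDiff_iterate_dirDeriv {g : E → ℝ} (hg : ContDiff ℝ ∞ g) (v : E) (n : ℕ) :
    ContDiff ℝ ∞ ((dirDeriv v)^[n] g) := by
  induction n with
  | zero => exact hg
  | succ n ih => rw [Function.iterate_succ_apply']; exact contDiff_dirDeriv ih v

lemma dirDeriv_comm {g : E → ℝ} (hg : ContDiff ℝ ∞ g) (v w : E) :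
    dirDeriv v (dirDeriv w g) = dirDeriv w (dirDeriv v g) := by
  have hd : Differentiable ℝ (fderiv ℝ g) :=
    (hg.fderiv_right (m := 1) (by norm_cast)).differentiable one_ne_zero
  have h : ∀ (v w p : E), dirDeriv v (dirDeriv w g) p = fderiv ℝ (fderiv ℝ g) p v w := by
    intro v w p
    have h1 : HasFDerivAt (dirDeriv w g) _ p :=
      (hd p).hasFDerivAt.clm_apply (hasFDerivAt_const w p)
    rw [dirDeriv, h1.fderiv]
    simp
  ext p
  rw [h, h]
  exact second_derivative_symmetric (fun q => (hg.differentiable (by simp) q).hasFDerivAt)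
    (hd p).hasFDerivAt v w

lemma dirDeriv_iterate_comm {g : E → ℝ} (hg : ContDiff ℝ ∞ g) (v w : E) (n : ℕ) :
    dirDeriv v ((dirDeriv w)^[n] g) = (dirDeriv w)^[n] (dirDeriv v g) := by
  induction n with
  | zero => rfl
  | succ n ih => rw [Function.iterate_succ_apply', Function.iterate_succ_apply',
      dirDeriv_comm (contDiff_iterate_dirDeriv hg w n), ih]

lemma hasDerivAt_comp_dirDeriv {g : E → ℝ} (hg : ContDiff ℝ ∞ g) {γ : ℝ → E} {v : E} {t : ℝ}
    (hγ : HasDerivAt γ v t) : HasDerivAt (fun t => g (γ t)) (dirDeriv v g (γ t)) t :=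
  (hg.differentiable (by simp) (γ t)).hasFDerivAt.comp_hasDerivAt t hγ

lemma iteratedDeriv_comp_eq {g : E → ℝ} (hg : ContDiff ℝ ∞ g) {γ : ℝ → E} {v : E}
    (hγ : ∀ t, HasDerivAt γ v t) (n : ℕ) (t : ℝ) :
    iteratedDeriv n (fun t => g (γ t)) t = (dirDeriv v)^[n] g (γ t) := by
  induction n generalizing g with
  | zero => simp
  | succ n ih =>
    rw [iteratedDeriv_succ', Function.iterate_succ_apply, ← ih (contDiff_dirDeriv hg v)]
    congr 1
    ext s
    exact (hasDerivAt_comp_dirDeriv hg (hγ s)).deriv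

end DirectionalDerivative

/-- The partial derivative `∂^{i+j+k} g / ∂x^i ∂y^j ∂z^k` of a function on `ℝ³`. -/
noncomputable def mixedDeriv (i j k : ℕ) (g : ℝ × ℝ × ℝ → ℝ) : ℝ × ℝ × ℝ → ℝ :=
  (dirDeriv (1, 0, 0))^[i] ((dirDeriv (0, 1, 0))^[j] ((dirDeriv (0, 0, 1))^[k] g))

section MixedDerivative

variable {g : ℝ × ℝ × ℝ → ℝ}

lemma contDiff_mixedDeriv (hg : ContDiff ℝ ∞ g) (i j k : ℕ) : ContDiff ℝ ∞ (mixedDeriv i j k g) :=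
  contDiff_iterate_dirDeriv (contDiff_iterate_dirDeriv (contDiff_iterate_dirDeriv hg _ k) _ j) _ i

lemma hasDerivAt_line_x (x y z : ℝ) : HasDerivAt (fun x : ℝ => (x, y, z)) (1, 0, 0) x :=
  (hasDerivAt_id x).prodMk (hasDerivAt_const x (y, z))

lemma hasDerivAt_line_y (x y z : ℝ) : HasDerivAt (fun y : ℝ => (x, y, z)) (0, 1, 0) y :=
  (hasDerivAt_const y x).prodMk ((hasDerivAt_id y).prodMk (hasDerivAt_const y z))

lemma hasDerivAt_line_z (x y z : ℝ) : HasDerivAt (fun z : ℝ => (x, y, z)) (0, 0, 1) z :=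
  (hasDerivAt_const z x).prodMk ((hasDerivAt_const z y).prodMk (hasDerivAt_id z))

lemma partialDeriv₃_eq_mixedDeriv (hg : ContDiff ℝ ∞ g) (i j k : ℕ) (x y z : ℝ) :
    partialDeriv₃ i j k (fun x y z => g (x, y, z)) x y z = mixedDeriv i j k g (x, y, z) := by
  have h1 : ∀ x y, iteratedDeriv k (fun z' => g (x, y, z')) z
      = (dirDeriv (0, 0, 1))^[k] g (x, y, z) := fun x y =>
    iteratedDeriv_comp_eq hg (fun t => hasDerivAt_line_z x y t) k z
  have h2 : ∀ x, iteratedDeriv j (fun y' => (dirDeriv (0, 0, 1))^[k] g (x, y', z)) y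
      = (dirDeriv (0, 1, 0))^[j] ((dirDeriv (0, 0, 1))^[k] g) (x, y, z) := fun x =>
    iteratedDeriv_comp_eq (contDiff_iterate_dirDeriv hg _ k) (fun t => hasDerivAt_line_y x t z) j y
  simp only [partialDeriv₃, h1, h2]
  exact iteratedDeriv_comp_eq (contDiff_iterate_dirDeriv (contDiff_iterate_dirDeriv hg _ k) _ j)
    (fun t => hasDerivAt_line_x t y z) i x

lemma dirDeriv_x_mixedDeriv (i j k : ℕ) :
    dirDeriv (1, 0, 0) (mixedDeriv i j k g) = mixedDeriv (i + 1) j k g := by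
  rw [mixedDeriv, mixedDeriv, Function.iterate_succ_apply']

lemma dirDeriv_y_mixedDeriv (hg : ContDiff ℝ ∞ g) (i j k : ℕ) :
    dirDeriv (0, 1, 0) (mixedDeriv i j k g) = mixedDeriv i (j + 1) k g := by
  rw [mixedDeriv, mixedDeriv, dirDeriv_iterate_comm
    (contDiff_iterate_dirDeriv (contDiff_iterate_dirDeriv hg _ k) _ j), Function.iterate_succ_apply']

lemma dirDeriv_z_mixedDeriv (hg : ContDiff ℝ ∞ g) (i j k : ℕ) :
    dirDeriv (0, 0, 1) (mixedDeriv i j k g) = mixedDeriv i j (k + 1) g := by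
  rw [mixedDeriv, mixedDeriv, dirDeriv_iterate_comm
    (contDiff_iterate_dirDeriv (contDiff_iterate_dirDeriv hg _ k) _ j),
    dirDeriv_iterate_comm (contDiff_iterate_dirDeriv hg _ k), Function.iterate_succ_apply']

/-- Smoothness makes directional derivatives commute, so a new derivative in any direction can be
moved into the fixed order of `mixedDeriv`. The estimates there thus cover all branches of the
recursive definition. -/
lemma symbolBound_mixedDeriv (hg : ContDiff ℝ ∞ g) {C : ℝ} (d : ℕ) : ∀ i j k : ℕ,
    (∀ i' j' k', i' + j' + k' ≤ i + j + k + d → ∀ x y z, |mixedDeriv i' j' k' g (x, y, z)|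
      ≤ C * decayWeight₃ x y z ^ (3 * (i' + j' + k' + 1))) →
    SymbolBound C d (i + j + k + 1) fun x y z => (mixedDeriv i j k g (x, y, z) : ℂ) := by
  induction d with
  | zero =>
    refine fun i j k h => ⟨?_, fun x y z => by simpa using h i j k (by omega) x y z⟩
    exact Complex.continuous_ofReal.comp (contDiff_mixedDeriv hg i j k).continuous
  | succ d ih =>
    intro i j k h
    have hs := contDiff_mixedDeriv hg i j k
    refine ⟨Complex.continuous_ofReal.comp hs.continuous,
      fun x y z => by simpa using h i j k (by omega) x y z,
      ⟨fun x y z => (mixedDeriv (i + 1) j k g (x, y, z) : ℂ), fun x y z => ?_, ?_⟩,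
      ⟨fun x y z => (mixedDeriv i (j + 1) k g (x, y, z) : ℂ), fun x y z => ?_, ?_⟩,
      fun x y z => (mixedDeriv i j (k + 1) g (x, y, z) : ℂ), fun x y z => ?_, ?_⟩
    · rw [← dirDeriv_x_mixedDeriv]
      exact (hasDerivAt_comp_dirDeriv hs (hasDerivAt_line_x x y z)).ofReal_comp
    · rw [show i + j + k + 1 + 1 = i + 1 + j + k + 1 by omega]
      exact ih _ _ _ fun i' j' k' h' => h i' j' k' (by omega)
    · rw [← dirDeriv_y_mixedDeriv hg]
      exact (hasDerivAt_comp_dirDeriv hs (hasDerivAt_line_y x y z)).ofReal_comp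
    · rw [show i + j + k + 1 + 1 = i + (j + 1) + k + 1 by omega]
      exact ih _ _ _ fun i' j' k' h' => h i' j' k' (by omega)
    · rw [← dirDeriv_z_mixedDeriv hg]
      exact (hasDerivAt_comp_dirDeriv hs (hasDerivAt_line_z x y z)).ofReal_comp
    · exact ih i j (k + 1) fun i' j' k' h' => h i' j' k' (by omega)

end MixedDerivative

lemma IsPreNormal₃.exists_symbolBound {f : ℝ → ℝ → ℝ → ℝ} (hf : IsPreNormal₃ ∅ f) (d : ℕ) :
    ∃ C, SymbolBound C d 1 fun x y z => (f x y z : ℂ) := by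
  set g : ℝ × ℝ × ℝ → ℝ := fun p => f p.1 p.2.1 p.2.2 with hgdef
  have hg : ContDiff ℝ ∞ g := by
    have := hf.smooth
    rwa [compl_empty, contDiffOn_univ] at this
  have key : ∀ i j k, ∃ C, 0 ≤ C ∧ ∀ x y z, |mixedDeriv i j k g (x, y, z)|
      ≤ C * decayWeight₃ x y z ^ (3 * (i + j + k + 1)) := by
    intro i j k
    refine IsOfDecrease₃.exists_le (g := fun x y z => mixedDeriv i j k g (x, y, z)) ?_
      (contDiff_mixedDeriv hg i j k).continuous
    have h1 : (fun x y z => mixedDeriv i j k g (x, y, z)) = partialDeriv₃ i j k f := by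
      ext x y z
      exact (partialDeriv₃_eq_mixedDeriv hg i j k x y z).symm
    rw [h1]
    rcases Nat.eq_zero_or_pos (i + j + k) with h0 | h0
    · obtain ⟨⟨rfl, rfl⟩, rfl⟩ : (i = 0 ∧ j = 0) ∧ k = 0 := by omega
      exact hf.decrease
    · exact hf.decrease_partialDeriv i j k h0
  choose c hc hb using key
  -- A single constant for all orders up to `d`: the sum of finitely many nonnegative constants
  -- dominates each of them.
  refine ⟨∑ p ∈ Finset.range (d + 1) ×ˢ Finset.range (d + 1) ×ˢ Finset.range (d + 1),
    c p.1 p.2.1 p.2.2, symbolBound_mixedDeriv hg d 0 0 0 fun i j k hijk x y z => (hb i j k x y z).trans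
      (mul_le_mul_of_nonneg_right ?_ (pow_nonneg (decayWeight₃_nonneg x y z) _))⟩
  refine Finset.single_le_sum (f := fun p : ℕ × ℕ × ℕ => c p.1 p.2.1 p.2.2) (a := (i, j, k))
    (fun p _ => hc _ _ _) ?_
  simp only [Finset.mem_product, Finset.mem_range]
  omega

/-! ### The six iterated transforms -/

lemma truncTransform_swap (k₁ k₂ r s : ℝ) {g : ℝ → ℝ → ℂ}
    (hg : Continuous fun p : ℝ × ℝ => g p.1 p.2) :
    (truncTransform k₂ s fun y => truncTransform k₁ r fun x => g x y)
      = truncTransform k₁ r fun x => truncTransform k₂ s fun y => g x y := by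
  simp only [truncTransform, ← intervalIntegral.integral_mul_const]
  have hg' : Continuous fun p : ℝ × ℝ => g p.2 p.1 := hg.comp continuous_swap
  rw [intervalIntegral_intervalIntegral_swap]
  · simp only [mul_right_comm]
  · have hc : Continuous (Function.uncurry fun y x =>
        g x y * fourierKernel k₁ x * fourierKernel k₂ y) :=
      (hg'.mul (by fun_prop : Continuous fun p : ℝ × ℝ => fourierKernel k₁ p.2)).mul
        (by fun_prop : Continuous fun p : ℝ × ℝ => fourierKernel k₂ p.1)
    exact (hc.continuousOn.integrableOn_compact (isCompact_uIcc.prod isCompact_uIcc)).mono_set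
      (prod_mono uIoc_subset_uIcc uIoc_subset_uIcc)

lemma truncTransform₂_eq_integral (k₁ k₂ : ℝ) (q : ℝ × ℝ) (g : ℝ → ℝ → ℂ) :
    truncTransform₂ k₁ k₂ q g = ∫ y in (-q.1)..q.1, ∫ x in (-q.2)..q.2,
      g x y * fourierKernel k₁ x * fourierKernel k₂ y := by
  simp only [truncTransform₂, truncTransform, ← intervalIntegral.integral_mul_const]

lemma truncTransform₃_eq_integral (k₁ k₂ k₃ : ℝ) (q : ℝ × ℝ × ℝ) (g : ℝ → ℝ → ℝ → ℂ) :
    truncTransform₃ k₁ k₂ k₃ q g = ∫ z in (-q.1)..q.1, ∫ y in (-q.2.1)..q.2.1,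
      ∫ x in (-q.2.2)..q.2.2,
        g x y z * fourierKernel k₁ x * fourierKernel k₂ y * fourierKernel k₃ z := by
  simp only [truncTransform₃, truncTransform₂, truncTransform,
    ← intervalIntegral.integral_mul_const]

namespace SymbolBound

variable {C k₁ k₂ k₃ : ℝ} {g : ℝ → ℝ → ℝ → ℂ}

lemma tendsto_truncTransform (h : SymbolBound C 3 1 g) (h₁ : k₁ ≠ 0) (y z : ℝ) :
    Tendsto (fun r => truncTransform k₁ r fun x => g x y z) atTop
      (𝓝 (improperTransform k₁ fun x => g x y z)) :=
  (h.decayC3.decayC1 y z).tendsto_truncTransform h₁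

lemma integrable (h : SymbolBound C 3 1 g) (h₁ : k₁ ≠ 0) (k₂ k₃ : ℝ) :
    Integrable fun p : ℝ × ℝ => improperTransform k₁ (fun x => g x p.1 p.2) *
      fourierKernel k₂ p.1 * fourierKernel k₃ p.2 :=
  integrable_mul_fourierKernel k₂ k₃ h₁ h.decayC3 (h.norm_improperTransform_le h₁)

lemma tendsto_truncTransform₂ (h : SymbolBound C 3 1 g) (h₁ : k₁ ≠ 0) (h₂ : k₂ ≠ 0) (z : ℝ) :
    Tendsto (fun q => truncTransform₂ k₁ k₂ q fun x y => g x y z) (atTop ×ˢ atTop)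
      (𝓝 (∫ y, improperTransform k₁ (fun x => g x y z) * fourierKernel k₂ y)) :=
  ((h.decayC3.decayC2 z).tendsto_truncTransform₂ h₁ h₂
    (integrable_mul_fourierKernel_section k₂ h₁ h.decayC3 (h.norm_improperTransform_le h₁) z)).1

lemma tendsto_truncTransform₃ (h : SymbolBound C 3 1 g) (h₁ : k₁ ≠ 0) (h₂ : k₂ ≠ 0)
    (h₃ : k₃ ≠ 0) :
    Tendsto (fun q => truncTransform₃ k₁ k₂ k₃ q g) (atTop ×ˢ atTop ×ˢ atTop)
      (𝓝 (∫ z, ∫ y, improperTransform k₁ (fun x => g x y z) * fourierKernel k₂ y *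
        fourierKernel k₃ z)) := by
  simp only [integral_mul_const]
  exact h.decayC3.tendsto_truncTransform₃ h₁ h₂ h₃ (h.norm_improperTransform_le h₁)

lemma integrable_integral_right (h : SymbolBound C 3 1 g) (h₁ : k₁ ≠ 0) (k₂ k₃ : ℝ) :
    Integrable fun z => (∫ y, improperTransform k₁ (fun x => g x y z) * fourierKernel k₂ y) *
      fourierKernel k₃ z := by
  simpa only [integral_mul_const] using (h.integrable h₁ k₂ k₃).integral_prod_right

lemma integrable_integral_left (h : SymbolBound C 3 1 g) (h₁ : k₁ ≠ 0) (k₂ k₃ : ℝ) :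
    Integrable fun y => (∫ z, improperTransform k₁ (fun x => g x y z) * fourierKernel k₃ z) *
      fourierKernel k₂ y := by
  simpa only [mul_right_comm _ (fourierKernel k₂ _), integral_mul_const]
    using (h.integrable h₁ k₂ k₃).integral_prod_left

lemma integral_integral_left (h : SymbolBound C 3 1 g) (h₁ : k₁ ≠ 0) (k₂ k₃ : ℝ) :
    (∫ y, (∫ z, improperTransform k₁ (fun x => g x y z) * fourierKernel k₃ z) *
      fourierKernel k₂ y) = ∫ z, ∫ y, improperTransform k₁ (fun x => g x y z) *
        fourierKernel k₂ y * fourierKernel k₃ z := by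
  rw [← integral_integral_swap (h.integrable h₁ k₂ k₃)]
  simp only [mul_right_comm _ (fourierKernel k₂ _), integral_mul_const]

/-- Both sides are limits of the same box integrals: on each box the order of the `x` and `y`
integrations is immaterial, and the two radii tend to infinity independently. -/
lemma integral_swap_xy (h : SymbolBound C 3 1 g) (h₁ : k₁ ≠ 0) (h₂ : k₂ ≠ 0) (h₃ : k₃ ≠ 0) :
    (∫ z, ∫ x, improperTransform k₂ (fun y => g x y z) * fourierKernel k₁ x * fourierKernel k₃ z)
      = ∫ z, ∫ y, improperTransform k₁ (fun x => g x y z) * fourierKernel k₂ y *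
        fourierKernel k₃ z := by
  have t : Tendsto (fun q : ℝ × ℝ × ℝ => (q.1, q.2.2, q.2.1)) (atTop ×ˢ atTop ×ˢ atTop)
      (atTop ×ˢ atTop ×ˢ atTop) :=
    tendsto_fst.prodMk ((tendsto_snd.comp tendsto_snd).prodMk (tendsto_fst.comp tendsto_snd))
  refine tendsto_nhds_unique ((h.swap_xy.tendsto_truncTransform₃ h₂ h₁ h₃).comp t)
    ((h.tendsto_truncTransform₃ h₁ h₂ h₃).congr fun q => ?_)
  simp only [truncTransform₃, truncTransform₂, Function.comp]
  congr 1; ext z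
  exact truncTransform_swap _ _ _ _ (h.continuous.comp (f := fun p : ℝ × ℝ => (p.1, p.2, z))
    (by fun_prop))

lemma integral_swap_yz (h : SymbolBound C 3 1 g) (h₁ : k₁ ≠ 0) (k₂ k₃ : ℝ) :
    (∫ y, ∫ z, improperTransform k₁ (fun x => g x y z) * fourierKernel k₃ z * fourierKernel k₂ y)
      = ∫ z, ∫ y, improperTransform k₁ (fun x => g x y z) * fourierKernel k₂ y *
        fourierKernel k₃ z := by
  rw [← h.integral_integral_left h₁]
  simp only [integral_mul_const]

end SymbolBound

theorem mainTheorem9 (f : ℝ → ℝ → ℝ → ℝ)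
    (hf : IsQuasiNormal₃ ∅ f ∨ IsQuasiSplitNormal₃ ∅ f) :
    ∃ A B C F G H : ℝ → ℝ → ℝ → ℂ,
      -- the limits defining the partial transforms exist
      (∀ k₁ : ℝ, k₁ ≠ 0 → ∀ y z : ℝ,
        Tendsto (fun r : ℝ => ∫ x in (-r)..r, (f x y z : ℂ) * fourierKernel k₁ x)
          atTop (𝓝 (A k₁ y z))) ∧
      (∀ k₂ : ℝ, k₂ ≠ 0 → ∀ x z : ℝ,
        Tendsto (fun r : ℝ => ∫ y in (-r)..r, (f x y z : ℂ) * fourierKernel k₂ y)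
          atTop (𝓝 (B x k₂ z))) ∧
      (∀ k₃ : ℝ, k₃ ≠ 0 → ∀ x y : ℝ,
        Tendsto (fun r : ℝ => ∫ z in (-r)..r, (f x y z : ℂ) * fourierKernel k₃ z)
          atTop (𝓝 (C x y k₃))) ∧
      (∀ k₁ k₂ : ℝ, k₁ ≠ 0 → k₂ ≠ 0 → ∀ z : ℝ,
        Tendsto (fun q : ℝ × ℝ => ∫ y in (-q.1)..q.1, ∫ x in (-q.2)..q.2,
            (f x y z : ℂ) * fourierKernel k₁ x * fourierKernel k₂ y)
          (atTop ×ˢ atTop) (𝓝 (F k₁ k₂ z))) ∧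
      (∀ k₁ k₃ : ℝ, k₁ ≠ 0 → k₃ ≠ 0 → ∀ y : ℝ,
        Tendsto (fun q : ℝ × ℝ => ∫ z in (-q.1)..q.1, ∫ x in (-q.2)..q.2,
            (f x y z : ℂ) * fourierKernel k₁ x * fourierKernel k₃ z)
          (atTop ×ˢ atTop) (𝓝 (G k₁ y k₃))) ∧
      (∀ k₂ k₃ : ℝ, k₂ ≠ 0 → k₃ ≠ 0 → ∀ x : ℝ,
        Tendsto (fun q : ℝ × ℝ => ∫ z in (-q.1)..q.1, ∫ y in (-q.2)..q.2,
            (f x y z : ℂ) * fourierKernel k₂ y * fourierKernel k₃ z)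
          (atTop ×ˢ atTop) (𝓝 (H x k₂ k₃))) ∧
      ∀ k₁ k₂ k₃ : ℝ, k₁ ≠ 0 → k₂ ≠ 0 → k₃ ≠ 0 →
        -- the integrals defining the full transforms converge absolutely
        Integrable (fun p : ℝ × ℝ => A k₁ p.1 p.2 * fourierKernel k₂ p.1 * fourierKernel k₃ p.2) ∧
        Integrable (fun p : ℝ × ℝ => B p.1 k₂ p.2 * fourierKernel k₁ p.1 * fourierKernel k₃ p.2) ∧
        Integrable (fun p : ℝ × ℝ => C p.1 p.2 k₃ * fourierKernel k₁ p.1 * fourierKernel k₂ p.2) ∧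
        Integrable (fun z : ℝ => F k₁ k₂ z * fourierKernel k₃ z) ∧
        Integrable (fun y : ℝ => G k₁ y k₃ * fourierKernel k₂ y) ∧
        Integrable (fun x : ℝ => H x k₂ k₃ * fourierKernel k₁ x) ∧
        -- they all agree, and they equal the limit of the integrals over boxes
        ∃ L : ℂ,
          (∫ z : ℝ, ∫ y : ℝ, A k₁ y z * fourierKernel k₂ y * fourierKernel k₃ z) = L ∧
          (∫ z : ℝ, ∫ x : ℝ, B x k₂ z * fourierKernel k₁ x * fourierKernel k₃ z) = L ∧
          (∫ y : ℝ, ∫ x : ℝ, C x y k₃ * fourierKernel k₁ x * fourierKernel k₂ y) = L ∧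
          (∫ z : ℝ, F k₁ k₂ z * fourierKernel k₃ z) = L ∧
          (∫ y : ℝ, G k₁ y k₃ * fourierKernel k₂ y) = L ∧
          (∫ x : ℝ, H x k₂ k₃ * fourierKernel k₁ x) = L ∧
          Tendsto (fun q : ℝ × ℝ × ℝ =>
              ∫ z in (-q.1)..q.1, ∫ y in (-q.2.1)..q.2.1, ∫ x in (-q.2.2)..q.2.2,
                (f x y z : ℂ) * fourierKernel k₁ x * fourierKernel k₂ y * fourierKernel k₃ z)
            (atTop ×ˢ atTop ×ˢ atTop) (𝓝 L) := by
  obtain ⟨K, h⟩ := (hf.elim (fun h => h.preNormal) fun h => h.preNormal).exists_symbolBound 3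
  -- The estimates are symmetric in the variables, so the results for a first transform in `x` apply
  -- with `y`, respectively `z`, moved to the first place.
  have hB := h.swap_xy
  have hC := h.swap_yz.swap_xy
  refine ⟨fun k y z => improperTransform k fun x => f x y z,
    fun x k z => improperTransform k fun y => f x y z,
    fun x y k => improperTransform k fun z => f x y z,
    fun k₁ k₂ z => ∫ y, improperTransform k₁ (fun x => f x y z) * fourierKernel k₂ y,
    fun k₁ y k₃ => ∫ z, improperTransform k₁ (fun x => f x y z) * fourierKernel k₃ z,
    fun x k₂ k₃ => ∫ z, improperTransform k₂ (fun y => f x y z) * fourierKernel k₃ z,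
    fun k₁ h₁ y z => h.tendsto_truncTransform h₁ y z,
    fun k₂ h₂ x z => hB.tendsto_truncTransform h₂ x z,
    fun k₃ h₃ x y => hC.tendsto_truncTransform h₃ x y,
    fun k₁ k₂ h₁ h₂ z => ?_, fun k₁ k₃ h₁ h₃ y => ?_, fun k₂ k₃ h₂ h₃ x => ?_,
    fun k₁ k₂ k₃ h₁ h₂ h₃ => ⟨h.integrable h₁ k₂ k₃, hB.integrable h₂ k₁ k₃,
      hC.integrable h₃ k₁ k₂, h.integrable_integral_right h₁ k₂ k₃,
      h.integrable_integral_left h₁ k₂ k₃, hB.integrable_integral_left h₂ k₁ k₃,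
      ∫ z, ∫ y, improperTransform k₁ (fun x => f x y z) * fourierKernel k₂ y * fourierKernel k₃ z,
      rfl, h.integral_swap_xy h₁ h₂ h₃, ?_, ?_, h.integral_integral_left h₁ k₂ k₃,
      (hB.integral_integral_left h₂ k₁ k₃).trans (h.integral_swap_xy h₁ h₂ h₃), ?_⟩⟩
  · simpa only [truncTransform₂_eq_integral] using h.tendsto_truncTransform₂ h₁ h₂ z
  · simpa only [truncTransform₂_eq_integral] using h.swap_yz.tendsto_truncTransform₂ h₁ h₃ y
  · simpa only [truncTransform₂_eq_integral] using hB.swap_yz.tendsto_truncTransform₂ h₂ h₃ x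
  -- First the roles of `x` and `z` are exchanged through box integrals, which replaces the
  -- transform in `z` by the one in `x`; then Fubini for the latter exchanges `y` and `z`.
  · exact (h.swap_yz.integral_swap_xy h₁ h₃ h₂).trans (h.integral_swap_yz h₁ k₂ k₃)
  · simp only [integral_mul_const]
  · simpa only [truncTransform₃_eq_integral] using h.tendsto_truncTransform₃ h₁ h₂ h₃
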